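/- For a partition $\lambda$, let $\omega(\lambda)$ be the number of ones in $\lambda$. The crank of $\lambda$ is the largest part of $\lambda$ if $\omega(\lambda)=0$, and otherwise it is the number of parts of $\lambda$ larger than $\omega(\lambda)$ minus $\omega(\lambda)$. Let $p(n)$ be the number of partitions of $n$ and $M(r,t,n)$ the number of partitions of $n$ whose crank is congruent to $r$ modulo $t$. Let $\zeta_{11}=e^{2\pi i/11}$ and, for $z$ in the upper half-plane, put $q=e^{2\pi i z}$ and $$\mathcal{K}^{(C)}_{11,0}(\zeta_{11},z)=\prod_{n=1}^{\infty}(1-q^{11n})\,\sum_{n=1}^{\infty}\left(\sum_{k=0}^{10}M(k,11,11n-5)\,\zeta_{11}^{k}\right)q^{n}.$$ Theorem (crank theorem modulo $11$). For every $z$ in the upper half-plane the product and the series above converge (unconditionally), and $$\mathcal{K}^{(C)}_{11,0}(\zeta_{11},z)=0 .$$ Moreover $$M(r,11,11n+6)=\tfrac{1}{11}\,p(11n+6)\qquad\text{for all } n\ge 0 \text{ and } 0\le r\le 10,$$ and the vanishing of $\mathcal{K}^{(C)}_{11,0}(\zeta_{11},z)$ for all $z$ in the upper half-plane is equivalent to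 this family of equalities. -/

import Mathlib

open scoped UpperHalfPlane

namespace CrankMod

/-- The crank of a partition: the largest part if there are no ones, and otherwise the number of
parts larger than `ω` minus `ω`, where `ω` is the number of ones.  (The empty partition has
crank `0`.) -/
def crank {n : ℕ} (P : n.Partition) : ℤ :=
  if P.parts.count 1 = 0 then (P.parts.sup : ℤ)
  else ((P.parts.filter (fun a => P.parts.count 1 < a)).card : ℤ) - (P.parts.count 1 : ℤ)

/-- `M r t n` is the number of partitions of `n` with crank congruent to `r` modulo `t`. -/
def M (r : ℤ) (t n : ℕ) : ℕ :=
  (Finset.univ.filter (fun P : n.Partition => crank P ≡ r [ZMOD (t : ℤ)])).card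

/-- `p n` is the number of partitions of `n`. -/
def p (n : ℕ) : ℕ := Fintype.card n.Partition

/-- `q = exp (2 π i z)`. -/
noncomputable def q (z : ℍ) : ℂ := Complex.exp (2 * Real.pi * Complex.I * (z : ℂ))

/-- `ζ_t = exp (2 π i / t)`. -/
noncomputable def zeta (t : ℕ) : ℂ := Complex.exp (2 * Real.pi * Complex.I / t)

/-- `s_t = (t ^ 2 - 1) / 24`; the division is exact for `t > 3` prime. -/
def s (t : ℕ) : ℕ := (t ^ 2 - 1) / 24

/-- The least summation index `⌈(s_t - m) / t⌉`.  For `t > 3` prime and `0 ≤ m ≤ t - 1` this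
ceiling is nonnegative, so that it may be taken in `ℕ`. -/
def startIndex (t m : ℕ) : ℕ := ⌈((s t : ℚ) - m) / t⌉₊

/-- The `n`-th term `(∑_{k = 0}^{t - 1} M(k, t, t n + m - s_t) ζ_t ^ (k ℓ)) q ^ n` of the series in
the crank dissection element.  For `n ≥ startIndex t m` the subtraction does not truncate. -/
noncomputable def dissectionTerm (t m l : ℕ) (z : ℍ) (n : ℕ) : ℂ :=
  (∑ k ∈ Finset.range t, (M k t (t * n + m - s t) : ℂ) * zeta t ^ (k * l)) * q z ^ n

/-- The element `K^{(C)}_{t,m}(ζ_t ^ ℓ, z)` of the `t`-dissection of the crank function, for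
`t > 3` prime, `0 ≤ m ≤ t - 1` and `1 ≤ ℓ ≤ t - 1`:
`q ^ (m / t) ∏_{n ≥ 1} (1 - q ^ (t n)) ∑_{n ≥ ⌈(s_t - m) / t⌉}
  (∑_{k = 0}^{t - 1} M(k, t, t n + m - s_t) ζ_t ^ (k ℓ)) q ^ n`. -/
noncomputable def K (t m l : ℕ) (z : ℍ) : ℂ :=
  Complex.exp (2 * Real.pi * Complex.I * (z : ℂ) * (m / t)) *
    (∏' n : ℕ, (1 - q z ^ (t * (n + 1)))) *
    ∑' n : Set.Ici (startIndex t m), dissectionTerm t m l z n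

end CrankMod

set_option linter.unusedSectionVars false

/-! Write (a)_∞ for `euler a` = ∏ (1 - a X^i), i ≥ 1. Sorting partitions by their number of ones, or
by largest part if there are none, and summing with Cauchy's q-binomial theorem gives the
Andrews–Garvan formula `crankSeries_mul`: up to the correction (1 - z)X, the generating function of
z^crank is (1)_∞ / ((z)_∞ (1/z)_∞).

At a primitive eleventh root ζ, multiply by ∏_k (ζ^k)_∞, a series in X^11 by `prod_euler_pow`. This
leaves (1)_∞² times the (ζ^k)_∞ with 2 ≤ k ≤ 9. Up to a nonzero constant that is Winquist's product
with a = ζ^5, b = ζ^2. Its expansion (`hasSum_winquist`) runs over lattice points (x, y) with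
exponent N satisfying 24N + 10 = (2x - 3)² + (2y - 1)². For N ≡ 6 mod 11 the right side is divisible
by 11; as -1 is not a square mod 11, 11 divides 2x - 3, and the reflection x ↦ 3 - x cancels the
terms in pairs (`coeff_winquist_eq_zero`).

So ∑ M(k, 11, 11n + 6) ζ^k = 0. The only rational relations among 1, ζ, …, ζ^10 are multiples of
their sum being zero, so the M's are equal; they add up to p(11n + 6). -/

namespace QSeries

open PowerSeries Filter Topology
open scoped PowerSeries.WithPiTopology

/-! ### X-adic convergence of sums and products, with discrete coefficients. -/

section Topology

variable {K : Type*} [Field K] [UniformSpace K] [DiscreteUniformity K] {ι κ : Type*}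

/-- A family of power series tends to zero in the `X`-adic sense. -/
def Small (f : ι → K⟦X⟧) : Prop := ∀ d : ℕ, {i | ¬ X ^ d ∣ f i}.Finite

theorem Small.summable {f : ι → K⟦X⟧} (h : Small f) : Summable f := by
  rw [WithPiTopology.summable_iff_summable_coeff]
  intro d
  refine summable_of_hasFiniteSupport ((h (d + 1)).subset fun i hi hd => hi ?_)
  exact X_pow_dvd_iff.mp hd d (Nat.lt_succ_self d)

theorem finite_support_coeff_of_summable {f : ι → K⟦X⟧} (h : Summable f) (d : ℕ) :
    {i | coeff d (f i) ≠ 0}.Finite := by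
  have h1 := ((WithPiTopology.summable_iff_summable_coeff K).mp h d).tendsto_cofinite_zero
  have h2 := h1 (show ({0} : Set K) ∈ 𝓝 0 by simp)
  rwa [mem_map, mem_cofinite] at h2

theorem small_of_summable {f : ι → K⟦X⟧} (h : Summable f) : Small f := by
  intro d
  refine ((Set.finite_lt_nat d).biUnion
    fun m _ => finite_support_coeff_of_summable h m).subset fun i hi => ?_
  simp only [Set.mem_ofPred_eq, X_pow_dvd_iff, not_forall] at hi
  obtain ⟨m, hm, hc⟩ := hi
  exact Set.mem_biUnion hm hc

theorem Small.mul {f : ι → K⟦X⟧} {g : κ → K⟦X⟧} (hf : Small f) (hg : Small g) :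
    Small fun x : ι × κ => f x.1 * g x.2 := fun d =>
  ((hf d).prod (hg d)).subset fun _ hx =>
    ⟨fun h => hx (h.mul_right _), fun h => hx (h.mul_left _)⟩

theorem hasSum_mul {f : ι → K⟦X⟧} {g : κ → K⟦X⟧} {a b : K⟦X⟧} (hf : HasSum f a)
    (hg : HasSum g b) : HasSum (fun x : ι × κ => f x.1 * g x.2) (a * b) :=
  hf.mul hg ((small_of_summable hf.summable).mul (small_of_summable hg.summable)).summable

theorem small_of_le {f : ℕ → K⟦X⟧} (h : ∀ i, X ^ i ∣ f i) : Small f := fun d =>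
  (Set.finite_lt_nat d).subset fun i hi => by
    by_contra hc
    exact hi ((pow_dvd_pow _ (not_lt.mp hc)).trans (h i))

theorem multipliable_one_sub {f : ℕ → K⟦X⟧} (h : ∀ i, X ^ i ∣ f i) :
    Multipliable fun i => 1 - f i := by
  simp_rw [sub_eq_add_neg]
  apply WithPiTopology.multipliable_one_add_of_tendsto_order_atTop_nhds_top
  refine ENat.tendsto_nhds_top_iff_natCast_lt.mpr fun n =>
    Filter.eventually_atTop.mpr ⟨n + 1, fun m hm => ?_⟩
  rw [order_neg]
  have h1 : (m : ℕ∞) ≤ (f m).order :=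
    nat_le_order _ _ fun i hi => X_pow_dvd_iff.mp (h m) i hi
  exact lt_of_lt_of_le (by exact_mod_cast hm) h1

theorem tendsto_of_dvd_sub {f : ℕ → K⟦X⟧} {a : K⟦X⟧} (h : ∀ n, X ^ n ∣ f n - a) :
    Tendsto f atTop (𝓝 a) := by
  rw [WithPiTopology.tendsto_iff_coeff_tendsto]
  refine fun d => tendsto_atTop_of_eventually_const (i₀ := d + 1) fun n hn => ?_
  have := X_pow_dvd_iff.mp (h n) d (by omega)
  rwa [map_sub, sub_eq_zero] at this

theorem dvd_tsum {f : ι → K⟦X⟧} (hf : Summable f) {n : ℕ} (h : ∀ i, X ^ n ∣ f i) :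
    X ^ n ∣ ∑' i, f i := by
  rw [X_pow_dvd_iff]
  intro m hm
  rw [hf.map_tsum (coeff m) (WithPiTopology.continuous_coeff K m)]
  simp [fun i => X_pow_dvd_iff.mp (h i) m hm]

theorem dvd_prod_one_sub_sub_one {f : ℕ → K⟦X⟧} {n : ℕ} (h : ∀ i, X ^ n ∣ f i)
    (s : Finset ℕ) : X ^ n ∣ ∏ i ∈ s, (1 - f i) - 1 := by
  induction s using Finset.cons_induction with
  | empty => simp
  | cons a s ha ih =>
    rw [Finset.prod_cons, show (1 - f a) * ∏ i ∈ s, (1 - f i) - 1 =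
      (∏ i ∈ s, (1 - f i) - 1) - f a * ∏ i ∈ s, (1 - f i) by ring]
    exact dvd_sub ih ((h a).mul_right _)

theorem dvd_tprod_one_sub_sub_one {f : ℕ → K⟦X⟧} (hf : Multipliable fun i => 1 - f i) {n : ℕ}
    (h : ∀ i, X ^ n ∣ f i) : X ^ n ∣ ∏' i, (1 - f i) - 1 := by
  have ht := hf.hasProd.tendsto_prod_nat
  rw [WithPiTopology.tendsto_iff_coeff_tendsto] at ht
  rw [X_pow_dvd_iff]
  intro m hm
  rw [map_sub, sub_eq_zero]
  refine tendsto_nhds_unique (ht m) (tendsto_atTop_of_eventually_const (i₀ := 0) fun i _ => ?_)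
  have := X_pow_dvd_iff.mp (dvd_prod_one_sub_sub_one h (Finset.range i)) m hm
  rwa [map_sub, sub_eq_zero] at this

end Topology

/-! ### Finite and infinite q-factorials. -/

section Products

variable {K : Type*} [Field K]

/-- The finite product `(X; X)_n`. -/
noncomputable def qfac (K : Type*) [Field K] (n : ℕ) : K⟦X⟧ :=
  ∏ i ∈ Finset.range n, (1 - X ^ (i + 1))

theorem qfac_succ (n : ℕ) : qfac K (n + 1) = qfac K n * (1 - X ^ (n + 1)) :=
  Finset.prod_range_succ _ _

theorem one_sub_X_pow_ne_zero {n : ℕ} (hn : n ≠ 0) : (1 - X ^ n : K⟦X⟧) ≠ 0 := by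
  intro h
  simpa [hn] using congrArg (constantCoeff (R := K)) h

theorem qfac_ne_zero (n : ℕ) : qfac K n ≠ 0 :=
  Finset.prod_ne_zero_iff.mpr fun _ _ => one_sub_X_pow_ne_zero (Nat.succ_ne_zero _)

theorem constantCoeff_qfac (n : ℕ) : constantCoeff (qfac K n) = 1 := by
  simp [qfac, map_prod]

theorem qfac_mul_inv (n : ℕ) : qfac K n * (qfac K n)⁻¹ = 1 :=
  PowerSeries.mul_inv_cancel _ (by simp [constantCoeff_qfac])

variable [UniformSpace K] [DiscreteUniformity K]

/-- The infinite product `(a X; X)_∞`. -/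
noncomputable def euler (a : K) : K⟦X⟧ := ∏' i : ℕ, (1 - C a * X ^ (i + 1))

theorem multipliable_euler (a : K) (k : ℕ) :
    Multipliable fun i : ℕ => (1 - C a * X ^ (i + k) : K⟦X⟧) :=
  multipliable_one_sub fun i => (pow_dvd_pow _ (Nat.le_add_right i k)).mul_left _

theorem constantCoeff_euler (a : K) : constantCoeff (euler a) = 1 := by
  have h : X ^ 1 ∣ euler a - 1 :=
    dvd_tprod_one_sub_sub_one (multipliable_euler a 1) fun i =>
      (pow_dvd_pow _ (Nat.le_add_left 1 i)).mul_left _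
  have := X_pow_dvd_iff.mp h 0 one_pos
  rw [map_sub, sub_eq_zero] at this
  simpa using this

/-- The tail `(a X^(n+1); X)_∞`. -/
noncomputable def eulerTail (a : K) (n : ℕ) : K⟦X⟧ := ∏' i : ℕ, (1 - C a * X ^ (i + n + 1))

theorem prod_mul_eulerTail (a : K) (n : ℕ) :
    (∏ i ∈ Finset.range n, (1 - C a * X ^ (i + 1))) * eulerTail a n = euler a :=
  Multipliable.prod_mul_tprod_nat_mul' (f := fun i => 1 - C a * X ^ (i + 1))
    (by simpa [add_assoc] using multipliable_euler a (n + 1))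

theorem qfac_mul_eulerTail (n : ℕ) : qfac K n * eulerTail 1 n = euler (1 : K) := by
  simpa [qfac] using prod_mul_eulerTail (1 : K) n

theorem dvd_eulerTail_sub_one (a : K) (n : ℕ) : X ^ (n + 1) ∣ eulerTail a n - 1 :=
  dvd_tprod_one_sub_sub_one (by simpa [add_assoc] using multipliable_euler a (n + 1))
    fun i => (pow_dvd_pow _ (by omega)).mul_left _

theorem tendsto_eulerTail (a : K) : Tendsto (eulerTail a) atTop (𝓝 1) :=
  tendsto_of_dvd_sub fun n => (pow_dvd_pow _ n.le_succ).trans (dvd_eulerTail_sub_one a n)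

end Products

/-! ### Cauchy's q-binomial theorem. -/

section CauchyBinomial

variable {K : Type*} [Field K]

/-- The quotient `(A; X)_j / (X; X)_j`. -/
noncomputable def pochRatio (A : K⟦X⟧) (j : ℕ) : K⟦X⟧ :=
  (∏ i ∈ Finset.range j, (1 - A * X ^ i)) * (qfac K j)⁻¹

theorem pochRatio_succ (A : K⟦X⟧) (j : ℕ) :
    (1 - X ^ (j + 1)) * pochRatio A (j + 1) = (1 - A * X ^ j) * pochRatio A j := by
  apply mul_right_cancel₀ (qfac_ne_zero (K := K) (j + 1))
  have h1 := qfac_mul_inv (K := K) (j + 1)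
  have h2 := qfac_mul_inv (K := K) j
  unfold pochRatio
  rw [Finset.prod_range_succ]
  set P := ∏ i ∈ Finset.range j, (1 - A * X ^ i)
  rw [show (1 - X ^ (j + 1)) * (P * (1 - A * X ^ j) * (qfac K (j + 1))⁻¹) * qfac K (j + 1) =
    (1 - X ^ (j + 1)) * (P * (1 - A * X ^ j)) * (qfac K (j + 1) * (qfac K (j + 1))⁻¹) by ring, h1,
    qfac_succ, show (1 - A * X ^ j) * (P * (qfac K j)⁻¹) * (qfac K j * (1 - X ^ (j + 1))) =
    (1 - A * X ^ j) * P * (1 - X ^ (j + 1)) * (qfac K j * (qfac K j)⁻¹) by ring, h2]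
  ring

@[simp] theorem pochRatio_zero (A : K⟦X⟧) : pochRatio A 0 = 1 := by
  simp [pochRatio, qfac]

variable [UniformSpace K] [DiscreteUniformity K]

theorem summable_cauchy (A : K⟦X⟧) (w : K) (N : ℕ) :
    Summable fun j : ℕ => pochRatio A j * (C w * X ^ (N + 1)) ^ j :=
  (small_of_le fun j => by
    rw [mul_pow, ← pow_mul]
    exact ((pow_dvd_pow _ (by nlinarith)).mul_left _).mul_left _).summable

/-- With F(t) = ∑ r_j t^j, the recurrence `pochRatio_succ` turns F(t) - F(tX) into t F(t) - A t
F(tX); here t = wX^(N+1). -/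
theorem cauchy_step (A : K⟦X⟧) (w : K) (N : ℕ) :
    (1 - C w * X ^ (N + 1)) * ∑' j : ℕ, pochRatio A j * (C w * X ^ (N + 1)) ^ j =
      (1 - A * C w * X ^ (N + 1)) * ∑' j : ℕ, pochRatio A j * (C w * X ^ (N + 2)) ^ j := by
  have s1 := summable_cauchy A w N
  have s2 := summable_cauchy A w (N + 1)
  rw [mul_assoc A]
  rw [show (C w * X ^ (N + 1 + 1) : K⟦X⟧) = C w * X ^ (N + 1) * X by ring] at s2
  rw [show (C w * X ^ (N + 2) : K⟦X⟧) = C w * X ^ (N + 1) * X by ring]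
  generalize (C w * X ^ (N + 1) : K⟦X⟧) = t at *
  have h1 := (s1.sub s2).tsum_eq_zero_add
  have h2 := (s1.mul_left t).tsum_sub (s2.mul_left (A * t))
  have h3 : ∀ j : ℕ, pochRatio A (j + 1) * t ^ (j + 1) - pochRatio A (j + 1) * (t * X) ^ (j + 1) =
      t * (pochRatio A j * t ^ j) - A * t * (pochRatio A j * (t * X) ^ j) := fun j => by
    rw [mul_pow, mul_pow]
    linear_combination t ^ (j + 1) * pochRatio_succ A j
  simp only [pow_zero, sub_self, zero_add, h3] at h1
  rw [s1.tsum_sub s2, h2, s1.tsum_mul_left, s2.tsum_mul_left] at h1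
  linear_combination h1

/-- **Cauchy's `q`-binomial theorem**. -/
theorem cauchy_binomial (A : K⟦X⟧) (w : K) :
    euler w * ∑' j : ℕ, pochRatio A j * (C w * X) ^ j = ∏' i : ℕ, (1 - A * C w * X ^ (i + 1)) := by
  set F : ℕ → K⟦X⟧ := fun N => ∑' j : ℕ, pochRatio A j * (C w * X ^ (N + 1)) ^ j with hF
  -- Iterate the functional equation; the remaining factor `F N` tends to 1.
  have hfin : ∀ N, (∏ i ∈ Finset.range N, (1 - C w * X ^ (i + 1))) * F 0 =
      (∏ i ∈ Finset.range N, (1 - A * C w * X ^ (i + 1))) * F N := by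
    intro N
    induction N with
    | zero => simp
    | succ N ih =>
      rw [Finset.prod_range_succ, Finset.prod_range_succ, mul_right_comm, ih]
      have := cauchy_step A w N
      simp only [hF]
      linear_combination (∏ i ∈ Finset.range N, (1 - A * C w * X ^ (i + 1))) * this
  have hF1 : Tendsto F atTop (𝓝 1) := tendsto_of_dvd_sub fun N => by
    simp only [hF]
    have hs := (summable_cauchy A w N).comp_injective (add_left_injective 1)
    rw [(summable_cauchy A w N).tsum_eq_zero_add, pochRatio_zero, pow_zero, mul_one,
      add_sub_cancel_left]
    refine dvd_tsum hs fun j => ?_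
    simp only [Function.comp_apply]
    rw [mul_pow, ← pow_mul]
    exact ((pow_dvd_pow _ (by nlinarith)).mul_left _).mul_left _
  have t1 := (multipliable_euler w 1).hasProd.tendsto_prod_nat.mul_const (F 0)
  have hm : Multipliable fun i : ℕ => 1 - A * C w * X ^ (i + 1) :=
    multipliable_one_sub fun i => (pow_dvd_pow _ (Nat.le_succ i)).mul_left _
  have t2 := hm.hasProd.tendsto_prod_nat.mul hF1
  simp_rw [hfin] at t1
  have := tendsto_nhds_unique t1 t2
  simpa [hF, euler] using this

end CauchyBinomial

/-! ### Triangular numbers over the integers. -/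

section Triangular

/-- The triangular number `k (k - 1) / 2` for an integer `k`. -/
def tri (k : ℤ) : ℕ := (k * (k - 1) / 2).toNat

theorem two_mul_tri (k : ℤ) : 2 * (tri k : ℤ) = k * (k - 1) := by
  have h0 : 0 ≤ k * (k - 1) := by
    rcases le_or_gt k 0 with h | h <;> nlinarith
  have h1 : 2 ∣ k * (k - 1) := (Int.even_mul_pred_self k).two_dvd
  unfold tri
  omega

theorem tri_add_one (k : ℤ) : (tri (k + 1) : ℤ) = tri k + k := by
  linarith [two_mul_tri k, two_mul_tri (k + 1)]

theorem tri_sub_one (k : ℤ) : (tri (k - 1) : ℤ) = tri k - (k - 1) := by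
  linarith [two_mul_tri k, two_mul_tri (k - 1)]

theorem finite_tri_le (d : ℕ) : {k : ℤ | tri k ≤ d}.Finite := by
  refine (Set.finite_Icc (-(d : ℤ)) (d + 1)).subset fun k hk => ?_
  have h1 := two_mul_tri k
  have h2 : (tri k : ℤ) ≤ d := by exact_mod_cast hk
  constructor
  · by_contra h
    nlinarith
  · by_contra h
    nlinarith

end Triangular

/-! ### Jacobi's triple product as a limit of a finite identity. -/

section TripleProduct

variable {K : Type*} [Field K]

/-- The inverse of `(X; X)_n`, extended by zero to negative `n`. -/
noncomputable def qfacInv (K : Type*) [Field K] : ℤ → K⟦X⟧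
  | Int.ofNat n => (qfac K n)⁻¹
  | Int.negSucc _ => 0

theorem qfacInv_natCast (n : ℕ) : qfacInv K n = (qfac K n)⁻¹ := rfl

theorem qfacInv_of_neg {n : ℤ} (h : n < 0) : qfacInv K n = 0 := by
  obtain ⟨m, rfl⟩ := Int.eq_negSucc_of_lt_zero h
  rfl

theorem qfacInv_sub_one (m : ℕ) : qfacInv K (m - 1) = (1 - X ^ m) * qfacInv K m := by
  cases m with
  | zero => simp [qfacInv_of_neg]
  | succ m =>
    rw [show ((m + 1 : ℕ) : ℤ) - 1 = (m : ℕ) by push_cast; ring, qfacInv_natCast, qfacInv_natCast]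
    apply mul_left_cancel₀ (qfac_ne_zero (K := K) (m + 1))
    rw [mul_left_comm, qfac_mul_inv, qfac_succ, mul_right_comm, qfac_mul_inv, mul_comm]

theorem qfacInv_sub_two (m : ℕ) :
    qfacInv K (m - 2) = (1 - X ^ m) * (1 - X ^ (m - 1)) * qfacInv K m := by
  cases m with
  | zero => simp [qfacInv_of_neg]
  | succ m =>
    have h1 := qfacInv_sub_one (K := K) m
    have h2 := qfacInv_sub_one (K := K) (m + 1)
    rw [show ((m + 1 : ℕ) : ℤ) - 1 = (m : ℕ) by push_cast; ring] at h2
    rw [show ((m + 1 : ℕ) : ℤ) - 2 = (m : ℕ) - 1 by push_cast; ring, h1, h2]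
    simp only [Nat.add_sub_cancel]
    ring

/-- The centred Gaussian binomial coefficient `[2N, N + k]`. -/
noncomputable def centralBinom (K : Type*) [Field K] (N : ℕ) (k : ℤ) : K⟦X⟧ :=
  qfac K (2 * N) * qfacInv K (N - k) * qfacInv K (N + k)

/-- What remains of the recurrence for `centralBinom` after removing common q-factorials. Where `m -
1` or `l - 1` truncates, the factor 1 - x^0 vanishes. -/
theorem centralBinom_recurrence_aux {R : Type*} [CommRing R] (x : R) (N m l : ℕ)
    (h : m + l = 2 * N + 2) :
    (1 - x ^ (2 * N + 1)) * (1 - x ^ (2 * N + 2)) =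
      (1 + x ^ (2 * N + 1)) * (1 - x ^ m) * (1 - x ^ l) +
        x ^ m * ((1 - x ^ l) * (1 - x ^ (l - 1))) +
        x ^ l * ((1 - x ^ m) * (1 - x ^ (m - 1))) := by
  rcases m with _ | m
  · obtain rfl : l = 2 * N + 2 := by omega
    simp
    ring
  rcases l with _ | l
  · obtain rfl : m = 2 * N + 1 := by omega
    simp
    ring
  · have : 2 * N = m + l := by omega
    rw [this]
    simp only [Nat.add_sub_cancel]
    ring

/-- The q-Pascal rule applied twice, as the upper index grows by two. -/
theorem centralBinom_succ (N : ℕ) (k : ℤ) (m l : ℕ) (hm : (m : ℤ) = N + 1 - k)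
    (hl : (l : ℤ) = N + 1 + k) :
    centralBinom K (N + 1) k = (1 + X ^ (2 * N + 1)) * centralBinom K N k +
      X ^ m * centralBinom K N (k - 1) + X ^ l * centralBinom K N (k + 1) := by
  unfold centralBinom
  rw [show ((N + 1 : ℕ) : ℤ) - k = m by push_cast; omega,
    show ((N + 1 : ℕ) : ℤ) + k = l by push_cast; omega,
    show (N : ℤ) - k = m - 1 by omega, show (N : ℤ) + k = l - 1 by omega,
    show (N : ℤ) - (k - 1) = m by omega, show (N : ℤ) + (k - 1) = l - 2 by omega,
    show (N : ℤ) - (k + 1) = m - 2 by omega, show (N : ℤ) + (k + 1) = l by omega,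
    qfacInv_sub_one, qfacInv_sub_one, qfacInv_sub_two, qfacInv_sub_two,
    show 2 * (N + 1) = 2 * N + 1 + 1 by ring, qfac_succ, qfac_succ]
  linear_combination qfac K (2 * N) * qfacInv K m * qfacInv K l *
    centralBinom_recurrence_aux (X : K⟦X⟧) N m l (by omega)

variable [UniformSpace K] [DiscreteUniformity K]

/-- The two new factors multiply to 1 + X^(2N+1) - aX^N - a⁻¹X^(N+1); the last two terms shift k by
one, which matches `centralBinom_succ`. -/
theorem hasSum_finite_triple_product {a : K} (ha : a ≠ 0) (N : ℕ) :
    HasSum (fun k : ℤ => C ((-a) ^ k) * X ^ tri k * centralBinom K N k)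
      ((∏ i ∈ Finset.range N, (1 - C a * X ^ i)) *
        ∏ i ∈ Finset.range N, (1 - C a⁻¹ * X ^ (i + 1))) := by
  induction N with
  | zero =>
    have h := hasSum_single (f := fun k : ℤ => C ((-a) ^ k) * X ^ tri k * centralBinom K 0 k) 0
      fun k hk => by
        rcases lt_or_gt_of_ne hk with h | h
        · simp [centralBinom, qfacInv_of_neg h]
        · simp [centralBinom, qfacInv_of_neg (neg_neg_of_pos h)]
    have h0 : qfacInv K 0 = 1 := by
      have := qfacInv_natCast (K := K) 0
      simpa [qfac] using this
    simpa [centralBinom, h0, tri, qfac] using h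
  | succ N ih =>
    rw [Finset.prod_range_succ, Finset.prod_range_succ]
    set P := (∏ i ∈ Finset.range N, (1 - C a * X ^ i)) *
        ∏ i ∈ Finset.range N, (1 - C a⁻¹ * X ^ (i + 1)) with hP
    have e1 := (Equiv.subRight (1 : ℤ)).hasSum_iff.mpr ih
    have e2 := (Equiv.addRight (1 : ℤ)).hasSum_iff.mpr ih
    have hs := ((ih.mul_left (1 + X ^ (2 * N + 1))).sub (e1.mul_left (C a * X ^ N))).sub
      (e2.mul_left (C a⁻¹ * X ^ (N + 1)))
    have hC : (C a * C a⁻¹ : K⟦X⟧) = 1 := by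
      rw [← map_mul, mul_inv_cancel₀ ha, map_one]
    have hv : (∏ i ∈ Finset.range N, (1 - C a * X ^ i)) * (1 - C a * X ^ N) *
        ((∏ i ∈ Finset.range N, (1 - C a⁻¹ * X ^ (i + 1))) * (1 - C a⁻¹ * X ^ (N + 1))) =
        (1 + X ^ (2 * N + 1)) * P - C a * X ^ N * P - C a⁻¹ * X ^ (N + 1) * P := by
      rw [hP]
      linear_combination ((∏ i ∈ Finset.range N, (1 - C a * X ^ i)) *
        ∏ i ∈ Finset.range N, (1 - C a⁻¹ * X ^ (i + 1))) * X ^ (2 * N + 1) * hC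
    rw [hv]
    refine Eq.mpr (congrArg (fun f : ℤ → K⟦X⟧ => HasSum f _) (funext fun k => ?_)) hs
    have c1 : (C a * C ((-a) ^ (k - 1)) : K⟦X⟧) = -C ((-a) ^ k) := by
      rw [← map_mul, ← map_neg, zpow_sub_one₀ (neg_ne_zero.mpr ha)]
      congr 1
      field_simp
    have c2 : (C a⁻¹ * C ((-a) ^ (k + 1)) : K⟦X⟧) = -C ((-a) ^ k) := by
      rw [← map_mul, ← map_neg, zpow_add_one₀ (neg_ne_zero.mpr ha)]
      congr 1
      field_simp
    simp only [Function.comp_apply, Equiv.subRight_apply, Equiv.coe_addRight]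
    -- For |k| > N + 1 every binomial involved is zero; otherwise both lower indices are natural
    -- numbers.
    by_cases hk : (N : ℤ) + 1 - k < 0 ∨ (N : ℤ) + 1 + k < 0
    · have z : ∀ M : ℕ, ∀ j : ℤ, (M : ℤ) - j < 0 ∨ (M : ℤ) + j < 0 →
          centralBinom K M j = 0 := by
        rintro M j (h | h) <;> simp [centralBinom, qfacInv_of_neg h]
      rw [z (N + 1) k (by push_cast; omega), z N k (by omega), z N (k - 1) (by omega),
        z N (k + 1) (by omega)]
      simp
    · obtain ⟨m, hm⟩ := Int.eq_ofNat_of_zero_le (a := (N : ℤ) + 1 - k) (by omega)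
      obtain ⟨l, hl⟩ := Int.eq_ofNat_of_zero_le (a := (N : ℤ) + 1 + k) (by omega)
      rw [centralBinom_succ N k m l hm.symm hl.symm]
      have x1 : (X ^ N * X ^ tri (k - 1) : K⟦X⟧) = X ^ tri k * X ^ m := by
        rw [← pow_add, ← pow_add]
        congr 1
        have := tri_sub_one k
        omega
      have x2 : (X ^ (N + 1) * X ^ tri (k + 1) : K⟦X⟧) = X ^ tri k * X ^ l := by
        rw [← pow_add, ← pow_add]
        congr 1
        have := tri_add_one k
        omega
      linear_combination
        (X ^ N * X ^ tri (k - 1) * centralBinom K N (k - 1)) * c1 +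
        (X ^ (N + 1) * X ^ tri (k + 1) * centralBinom K N (k + 1)) * c2 -
        C ((-a) ^ k) * centralBinom K N (k - 1) * x1 -
        C ((-a) ^ k) * centralBinom K N (k + 1) * x2

theorem euler_mul_inv (a : K) : euler a * (euler a)⁻¹ = 1 :=
  PowerSeries.mul_inv_cancel _ (by simp [constantCoeff_euler])

theorem tendsto_qfacInv (k : ℤ) :
    Tendsto (fun N : ℕ => qfacInv K (N + k)) atTop (𝓝 (euler (1 : K))⁻¹) := by
  have h1 : ∀ n : ℕ, qfacInv K n = eulerTail 1 n * (euler (1 : K))⁻¹ := fun n => by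
    apply mul_left_cancel₀ (qfac_ne_zero (K := K) n)
    rw [qfacInv_natCast, qfac_mul_inv, ← mul_assoc, qfac_mul_eulerTail, euler_mul_inv]
  have h2 : Tendsto (fun n : ℕ => qfacInv K n) atTop (𝓝 (euler (1 : K))⁻¹) := by
    simp_rw [h1]
    simpa using (tendsto_eulerTail (1 : K)).mul_const (euler (1 : K))⁻¹
  have h3 : Tendsto (fun N : ℕ => ((N : ℤ) + k).toNat) atTop atTop :=
    tendsto_atTop.mpr fun b => eventually_atTop.mpr ⟨b + k.natAbs, fun N hN => by omega⟩
  refine (h2.comp h3).congr' (eventually_atTop.mpr ⟨k.natAbs, fun N hN => ?_⟩)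
  simp only [Function.comp_apply]
  rw [Int.toNat_of_nonneg (by omega)]

theorem tendsto_centralBinom (k : ℤ) :
    Tendsto (fun N : ℕ => euler (1 : K) * centralBinom K N k) atTop (𝓝 1) := by
  have h1 : Tendsto (fun n : ℕ => qfac K n) atTop (𝓝 (euler 1)) := by
    have := (multipliable_euler (1 : K) 1).hasProd.tendsto_prod_nat
    simpa [qfac, euler] using this
  have h2 : Tendsto (fun N : ℕ => 2 * N) atTop atTop :=
    tendsto_atTop.mpr fun b => eventually_atTop.mpr ⟨b, fun N hN => by omega⟩
  have h3 := (((h1.comp h2).mul (tendsto_qfacInv (K := K) (-k))).mul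
    (tendsto_qfacInv (K := K) k)).const_mul (euler (1 : K))
  rw [euler_mul_inv, one_mul, euler_mul_inv] at h3
  simpa [centralBinom, sub_eq_add_neg] using h3

/-- **Jacobi's triple product identity**. -/
theorem hasSum_triple_product {a : K} (ha : a ≠ 0) :
    HasSum (fun k : ℤ => C ((-a) ^ k) * X ^ tri k)
      (euler 1 * ((1 - C a) * euler a * euler a⁻¹)) := by
  have hprod : Tendsto (fun N => ∏ i ∈ Finset.range N, (1 - C a * X ^ i : K⟦X⟧)) atTop
      (𝓝 ((1 - C a) * euler a)) := by
    have := (multipliable_euler a 0).hasProd.tendsto_prod_nat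
    rw [← Multipliable.prod_mul_tprod_nat_mul' (k := 1) (by simpa using multipliable_euler a 1)]
      at this
    simpa [euler] using this
  have hlim := (hprod.mul (multipliable_euler a⁻¹ 1).hasProd.tendsto_prod_nat).const_mul
    (euler (1 : K))
  rw [WithPiTopology.hasSum_iff_hasSum_coeff]
  intro d
  -- Only finitely many k reach degree d, uniformly in N, so the limit passes through the sum.
  have hsupp : ∀ f : ℤ → K⟦X⟧, ∀ k ∉ (finite_tri_le d).toFinset,
      coeff d (C ((-a) ^ k) * X ^ tri k * f k) = 0 := fun f k hk => by
    have hk' : d < tri k := by simpa using hk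
    exact X_pow_dvd_iff.mp ((Dvd.intro_left _ rfl).mul_right _) d hk'
  have hfin : ∀ N : ℕ, coeff d (euler 1 * ((∏ i ∈ Finset.range N, (1 - C a * X ^ i)) *
        ∏ i ∈ Finset.range N, (1 - C a⁻¹ * X ^ (i + 1)))) = ∑ k ∈ (finite_tri_le d).toFinset,
        coeff d (C ((-a) ^ k) * X ^ tri k * (euler 1 * centralBinom K N k)) := fun N => by
    have h1 := (hasSum_finite_triple_product ha N).mul_left (euler (1 : K))
    have h2 := (WithPiTopology.hasSum_iff_hasSum_coeff K).mp h1 d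
    refine h2.unique ?_
    simp_rw [mul_left_comm (euler (1 : K))]
    exact hasSum_sum_of_ne_finset_zero (hsupp _)
  rw [WithPiTopology.tendsto_iff_coeff_tendsto] at hlim
  have h1 := hlim d
  simp_rw [hfin] at h1
  have h2 : Tendsto (fun N : ℕ => ∑ k ∈ (finite_tri_le d).toFinset,
      coeff d (C ((-a) ^ k) * X ^ tri k * (euler 1 * centralBinom K N k))) atTop
      (𝓝 (∑ k ∈ (finite_tri_le d).toFinset, coeff d (C ((-a) ^ k) * X ^ tri k * 1))) := by
    refine tendsto_finsetSum _ fun k _ => ?_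
    exact ((WithPiTopology.continuous_coeff K d).tendsto _).comp
      ((tendsto_centralBinom k).const_mul _)
  have h3 := tendsto_nhds_unique h1 h2
  change coeff d (euler 1 * ((1 - C a) * euler a * euler a⁻¹)) = _ at h3
  rw [h3]
  simp only [mul_one]
  exact hasSum_sum_of_ne_finset_zero fun k hk => by simpa using hsupp (fun _ => 1) k hk

end TripleProduct

/-! ### Winquist's identity and its coefficients modulo 11. -/

section Winquist

variable {K : Type*} [Field K] [UniformSpace K] [DiscreteUniformity K]

/-- Both signs are needed: they arise from the two nonzero inner residue classes in Winquist's
identity. -/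
theorem hasSum_pentagonal {ε : ℤ} (hε : ε = 1 ∨ ε = -1) :
    HasSum (fun k : ℤ => C ((-1 : K) ^ k) * X ^ pentagonal (ε * k)) (euler (1 : K)) := by
  have h := WithPiTopology.hasSum_pentagonalSeries K
  rw [← WithPiTopology.tprod_one_sub_X_pow] at h
  have hs : ∀ k : ℤ, ((Int.negOnePow k : ℤ) : K⟦X⟧) = C ((-1 : K) ^ k) := fun k => by
    rcases Int.even_or_odd k with hk | hk
    · simp [Int.negOnePow_even k hk, hk.neg_one_zpow]
    · simp [Int.negOnePow_odd k hk, hk.neg_one_zpow]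
  simp_rw [hs] at h
  have he : euler (1 : K) = ∏' n : ℕ, (1 - X ^ (n + 1)) := by simp [euler]
  rw [he]
  rcases hε with rfl | rfl
  · simpa using h
  · have h2 := (Equiv.neg ℤ).hasSum_iff.mpr h
    have h3 : ∀ k : ℤ, ((-1 : K) ^ k)⁻¹ = (-1) ^ k := fun k => by
      rw [← inv_zpow, inv_neg_one]
    simpa [Function.comp_def, h3] using h2

/-- The coordinates `(x, y) = (k + m + n, l + m - n)` on the index set of a product of four theta
series. -/
def windexEquiv : (ℤ × ℤ) × (ℤ × ℤ) ≃ (ℤ × ℤ) × (ℤ × ℤ) where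
  toFun p := ((p.1.1 - p.2.1 - p.2.2, p.1.2 - p.2.1 + p.2.2), p.2)
  invFun p := ((p.1.1 + p.2.1 + p.2.2, p.1.2 + p.2.1 - p.2.2), p.2)
  left_inv p := by ext <;> simp <;> ring
  right_inv p := by ext <;> simp <;> ring

/-- The exponent of a term in a product of four theta series. -/
def wterm (x y m n : ℤ) : ℕ := tri (x - m - n) + tri (y - m + n) + (tri m + tri n)

/-- For fixed x, y the variables m and n separate, so the inner double sum factors. -/
theorem two_mul_wterm (x y m n : ℤ) : 2 * (wterm x y m n : ℤ) =
    x ^ 2 + y ^ 2 - x - y + (3 * m ^ 2 - (2 * (x + y) - 1) * m) +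
      (3 * n ^ 2 - (2 * (x - y) + 1) * n) := by
  simp only [wterm, Nat.cast_add, mul_add, two_mul_tri]
  ring

/-- The lattice points that contribute to Winquist's identity. -/
def Good (p : ℤ × ℤ) : Prop := (p.1 + p.2) % 3 ≠ 2 ∧ (p.1 - p.2 + 1) % 3 ≠ 2

instance : DecidablePred Good := fun p => by unfold Good; infer_instance

/-- The exponent of a term in Winquist's identity. -/
def wexp (p : ℤ × ℤ) : ℕ := wterm p.1 p.2 ((p.1 + p.2) / 3) ((p.1 - p.2 + 1) / 3)

/-- The exponent of `-1` in a term of Winquist's identity. -/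
def wsign (p : ℤ × ℤ) : ℤ := p.1 + p.2 - (p.1 + p.2) / 3 + (p.1 - p.2 + 1) / 3

/-- Complete the squares in m and n: at the chosen quotients each square equals 1. -/
theorem wexp_eq {p : ℤ × ℤ} (hp : Good p) :
    24 * (wexp p : ℤ) + 10 = (2 * p.1 - 3) ^ 2 + (2 * p.2 - 1) ^ 2 := by
  obtain ⟨x, y⟩ := p
  obtain ⟨h1, h2⟩ := hp
  have h := two_mul_wterm x y ((x + y) / 3) ((x - y + 1) / 3)
  simp only [wexp] at *
  generalize hu : (x + y) / 3 = u at *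
  generalize hv : (x - y + 1) / 3 = v at *
  have c1 : (6 * u - (2 * (x + y) - 1)) ^ 2 = 1 := by
    have : 6 * u - (2 * (x + y) - 1) = 1 ∨ 6 * u - (2 * (x + y) - 1) = -1 := by omega
    rcases this with h | h <;> simp [h]
  have c2 : (6 * v - (2 * (x - y) + 1)) ^ 2 = 1 := by
    have : 6 * v - (2 * (x - y) + 1) = 1 ∨ 6 * v - (2 * (x - y) + 1) = -1 := by omega
    rcases this with h | h <;> simp [h]
  linear_combination 12 * h + c1 + c2

/-- A term in Winquist's identity. -/
noncomputable def wcoeff (a b : K) (p : ℤ × ℤ) : K⟦X⟧ :=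
  if Good p then C (a ^ p.1 * b ^ p.2 * (-1) ^ wsign p) * X ^ wexp p else 0

/-- Regroups the product by the exponents x of a and y of b. -/
theorem hasSum_four_theta {a b : K} (ha : a ≠ 0) (hb : b ≠ 0) {A B D E : K⟦X⟧}
    (hA : HasSum (fun k : ℤ => C ((-a) ^ k) * X ^ tri k) A)
    (hB : HasSum (fun k : ℤ => C ((-b) ^ k) * X ^ tri k) B)
    (hD : HasSum (fun k : ℤ => C ((-(a * b)) ^ k) * X ^ tri k) D)
    (hE : HasSum (fun k : ℤ => C ((-(a / b)) ^ k) * X ^ tri k) E) :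
    HasSum (fun p : (ℤ × ℤ) × (ℤ × ℤ) =>
      (C (a ^ p.1.1 * b ^ p.1.2 * (-1) ^ (p.1.1 + p.1.2 - p.2.1 + p.2.2)) *
        X ^ wterm p.1.1 p.1.2 p.2.1 p.2.2 : K⟦X⟧)) (A * B * (D * E)) := by
  have h := windexEquiv.hasSum_iff.mpr (hasSum_mul (hasSum_mul hA hB) (hasSum_mul hD hE))
  refine Eq.mpr (congrArg (fun f : (ℤ × ℤ) × (ℤ × ℤ) → K⟦X⟧ => HasSum f _)
    (funext fun p => ?_)) h
  obtain ⟨⟨x, y⟩, m, n⟩ := p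
  simp only [Function.comp_apply, windexEquiv, Equiv.coe_fn_mk, wterm]
  have hc : a ^ x * b ^ y * (-1) ^ (x + y - m + n) = (-a) ^ (x - m - n) * (-b) ^ (y - m + n) *
      ((-(a * b)) ^ m * (-(a / b)) ^ n) := by
    have h1 : (-1 : K) ≠ 0 := neg_ne_zero.mpr one_ne_zero
    rw [neg_eq_neg_one_mul a, neg_eq_neg_one_mul b, neg_eq_neg_one_mul (a * b),
      neg_eq_neg_one_mul (a / b)]
    simp only [mul_zpow, div_zpow, zpow_sub₀ ha, zpow_sub₀ hb, zpow_add₀ hb, zpow_sub₀ h1,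
      zpow_add₀ h1]
    have := zpow_ne_zero m ha
    have := zpow_ne_zero n ha
    have := zpow_ne_zero m hb
    have := zpow_ne_zero n hb
    have := zpow_ne_zero m h1
    have := zpow_ne_zero n h1
    field_simp
  rw [hc]
  simp only [map_mul, pow_add]
  ring

theorem eq_zero_of_hasSum_antisymm [CharZero K] {ι R : Type*} [AddCommGroup R] [Module K R]
    [TopologicalSpace R] [IsTopologicalAddGroup R] [T2Space R] {f : ι → R} {s : R}
    (h : HasSum f s) (φ : ι ≃ ι) (hφ : ∀ i, f (φ i) = -f i) : s = 0 := by
  have h1 := φ.hasSum_iff.mpr h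
  have h2 : f ∘ φ = fun i => -f i := funext hφ
  rw [h2] at h1
  have h3 : s = -s := h1.unique h.neg
  have h4 : (2 : K) • s = 0 := by
    rw [two_smul]
    nth_rewrite 1 [h3]
    exact neg_add_cancel s
  exact (smul_eq_zero.mp h4).resolve_left two_ne_zero

/-- Modulo 3, x + y governs the sum over m and x - y + 1 the sum over n. In class 2 a reflection
preserves the exponent and flips the sign, so the sum vanishes; otherwise a shift makes it a
pentagonal series, contributing one `euler 1`. -/
theorem hasSum_winquist_inner [CharZero K] {a b : K} (p : ℤ × ℤ)
    (hs : Summable fun c : ℤ × ℤ => (C (a ^ p.1 * b ^ p.2 * (-1) ^ (p.1 + p.2 - c.1 + c.2)) *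
        X ^ wterm p.1 p.2 c.1 c.2 : K⟦X⟧)) :
    HasSum (fun c : ℤ × ℤ => (C (a ^ p.1 * b ^ p.2 * (-1) ^ (p.1 + p.2 - c.1 + c.2)) *
        X ^ wterm p.1 p.2 c.1 c.2 : K⟦X⟧)) (euler 1 ^ 2 * wcoeff a b p) := by
  have h1 : (-1 : K) ≠ 0 := neg_ne_zero.mpr one_ne_zero
  obtain ⟨x, y⟩ := p
  unfold wcoeff
  split_ifs with hp
  · obtain ⟨g1, g2⟩ := hp
    simp only [wexp, wsign] at *
    generalize hu : (x + y) / 3 = u at *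
    generalize hv : (x - y + 1) / 3 = v at *
    obtain ⟨ε, hε, c1⟩ : ∃ ε : ℤ, (ε = 1 ∨ ε = -1) ∧ 2 * (x + y) - 1 = 6 * u + ε := by
      have : x + y = 3 * u ∨ x + y = 3 * u + 1 := by omega
      rcases this with h | h
      · exact ⟨-1, Or.inr rfl, by omega⟩
      · exact ⟨1, Or.inl rfl, by omega⟩
    obtain ⟨δ, hδ, c2⟩ : ∃ δ : ℤ, (δ = 1 ∨ δ = -1) ∧ 2 * (x - y) + 1 = 6 * v + δ := by
      have : x - y + 1 = 3 * v ∨ x - y + 1 = 3 * v + 1 := by omega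
      rcases this with h | h
      · exact ⟨-1, Or.inr rfl, by omega⟩
      · exact ⟨1, Or.inl rfl, by omega⟩
    have h := (hasSum_mul (hasSum_pentagonal (K := K) hε) (hasSum_pentagonal (K := K) hδ)).mul_left
      (C (a ^ x * b ^ y * (-1) ^ (x + y - u + v)) * X ^ wterm x y u v)
    rw [← (Equiv.addRight ((u, v) : ℤ × ℤ)).hasSum_iff,
      show euler (1 : K) ^ 2 * (C (a ^ x * b ^ y * (-1) ^ (x + y - u + v)) * X ^ wterm x y u v) =
      C (a ^ x * b ^ y * (-1) ^ (x + y - u + v)) * X ^ wterm x y u v * (euler 1 * euler 1) by ring]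
    refine Eq.mpr (congrArg (fun f : ℤ × ℤ → K⟦X⟧ => HasSum f _) (funext fun c => ?_)) h
    obtain ⟨m, n⟩ := c
    simp only [Function.comp_apply, Equiv.coe_addRight, Prod.mk_add_mk]
    have hexp : wterm x y (m + u) (n + v) =
        wterm x y u v + (pentagonal (ε * m) + pentagonal (δ * n)) := by
      have e1 := two_mul_wterm x y (m + u) (n + v)
      have e2 := two_mul_wterm x y u v
      have e3 := two_mul_natCast_pentagonal (ε * m)
      have e4 := two_mul_natCast_pentagonal (δ * n)
      have e5 : ε * ε = 1 := by rcases hε with rfl | rfl <;> rfl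
      have e6 : δ * δ = 1 := by rcases hδ with rfl | rfl <;> rfl
      zify
      refine mul_left_cancel₀ (two_ne_zero (α := ℤ)) ?_
      rw [mul_add, mul_add, e1, e2, e3, e4]
      linear_combination (-m) * c1 - n * c2 - 3 * m ^ 2 * e5 - 3 * n ^ 2 * e6
    have hsg : (-1 : K) ^ (x + y - (m + u) + (n + v)) =
        (-1) ^ (x + y - u + v) * ((-1) ^ m * (-1) ^ n) := by
      rw [← zpow_add₀ h1, ← zpow_add₀ h1]
      rw [show x + y - (m + u) + (n + v) = x + y - u + v + (m + n) + (-2) * m by ring,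
        zpow_add₀ h1 _ (-2 * m), zpow_mul]
      simp
    rw [hexp, hsg]
    simp only [map_mul, pow_add]
    ring
  · rw [mul_zero]
    have hzero := hs.hasSum
    suffices h : ∃ φ : ℤ × ℤ ≃ ℤ × ℤ, ∀ c : ℤ × ℤ, wterm x y (φ c).1 (φ c).2 = wterm x y c.1 c.2 ∧
        Odd (c.1 - (φ c).1 - c.2 + (φ c).2) by
      obtain ⟨φ, hφ⟩ := h
      rwa [eq_zero_of_hasSum_antisymm (K := K) hzero φ fun c => ?_] at hzero
      obtain ⟨h2, h3⟩ := hφ c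
      simp only [h2]
      rw [show x + y - (φ c).1 + (φ c).2 = x + y - c.1 + c.2 + (c.1 - (φ c).1 - c.2 + (φ c).2) by
        ring, zpow_add₀ h1, h3.neg_one_zpow]
      simp
    unfold Good at hp
    by_cases g1 : (x + y) % 3 = 2
    · obtain ⟨u, hu⟩ : ∃ u, x + y = 3 * u + 2 := ⟨(x + y) / 3, by omega⟩
      refine ⟨(Equiv.subLeft (2 * u + 1)).prodCongr (Equiv.refl ℤ), fun c => ⟨?_, ?_⟩⟩
      · simp only [Equiv.prodCongr_apply, Prod.map, Equiv.subLeft_apply, Equiv.refl_apply]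
        zify
        refine mul_left_cancel₀ (two_ne_zero (α := ℤ)) ?_
        rw [two_mul_wterm, two_mul_wterm]
        linear_combination (2 * c.1 - 2 * (2 * u + 1 - c.1)) * hu
      · simp only [Equiv.prodCongr_apply, Prod.map, Equiv.subLeft_apply, Equiv.refl_apply]
        exact ⟨c.1 - u - 1, by ring⟩
    · obtain ⟨v, hv⟩ : ∃ v, x - y + 1 = 3 * v + 2 := ⟨(x - y + 1) / 3, by
        have : (x - y + 1) % 3 = 2 := by
          by_contra h
          exact hp ⟨g1, h⟩
        omega⟩
      refine ⟨(Equiv.refl ℤ).prodCongr (Equiv.subLeft (2 * v + 1)), fun c => ⟨?_, ?_⟩⟩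
      · simp only [Equiv.prodCongr_apply, Prod.map, Equiv.subLeft_apply, Equiv.refl_apply]
        zify
        refine mul_left_cancel₀ (two_ne_zero (α := ℤ)) ?_
        rw [two_mul_wterm, two_mul_wterm]
        linear_combination (2 * c.2 - 2 * (2 * v + 1 - c.2)) * hv
      · simp only [Equiv.prodCongr_apply, Prod.map, Equiv.subLeft_apply, Equiv.refl_apply]
        exact ⟨v - c.2, by ring⟩

/-- The theta product `(1 - a) (a X; X)_∞ (X / a; X)_∞`. -/
noncomputable def thetaProd (a : K) : K⟦X⟧ := (1 - C a) * euler a * euler a⁻¹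

/-- **Winquist's identity**. -/
theorem hasSum_winquist [CharZero K] {a b : K} (ha : a ≠ 0) (hb : b ≠ 0) :
    HasSum (wcoeff a b) (euler 1 ^ 2 *
      (thetaProd a * thetaProd b * thetaProd (a * b) * thetaProd (a / b))) := by
  have h := hasSum_four_theta ha hb (hasSum_triple_product ha) (hasSum_triple_product hb)
    (hasSum_triple_product (mul_ne_zero ha hb)) (hasSum_triple_product (div_ne_zero ha hb))
  have h1 := h.prod_fiberwise fun p => hasSum_winquist_inner p (h.summable.prod_factor p)
  -- The four theta series carry `euler 1 ^ 4`; the inner sums account for two of these factors.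
  have h2 := h1.mul_left ((euler (1 : K))⁻¹ ^ 2)
  have h3 : (euler (1 : K))⁻¹ ^ 2 * euler 1 ^ 2 = 1 := by
    rw [← mul_pow, mul_comm, euler_mul_inv, one_pow]
  simp_rw [← mul_assoc _ _ (wcoeff a b _), h3, one_mul] at h2
  rwa [show (euler (1 : K))⁻¹ ^ 2 * (euler 1 * ((1 - C a) * euler a * euler a⁻¹) *
      (euler 1 * ((1 - C b) * euler b * euler b⁻¹)) *
      (euler 1 * ((1 - C (a * b)) * euler (a * b) * euler (a * b)⁻¹) *
      (euler 1 * ((1 - C (a / b)) * euler (a / b) * euler (a / b)⁻¹)))) =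
      (euler (1 : K))⁻¹ ^ 2 * euler 1 ^ 2 * (euler 1 ^ 2 *
      (thetaProd a * thetaProd b * thetaProd (a * b) * thetaProd (a / b))) by
    unfold thetaProd; ring, h3, one_mul] at h2

theorem sq_add_sq_eq_zero_zmod_eleven : ∀ u v : ZMod 11, u ^ 2 + v ^ 2 = 0 → u = 0 := by
  decide

/-- The involution x ↦ 3 - x keeps the exponent and flips the sign of a good term. It also keeps
(ζ^5)^x, since 11 ∣ 2x - 3 whenever the exponent is 11n + 6. -/
theorem coeff_winquist_eq_zero [CharZero K] {ζ : K} (hζ : ζ ^ 11 = 1) (n : ℕ) :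
    coeff (11 * n + 6) (euler 1 ^ 2 * (thetaProd (ζ ^ 5) * thetaProd (ζ ^ 2) *
      thetaProd (ζ ^ 5 * ζ ^ 2) * thetaProd (ζ ^ 5 / ζ ^ 2))) = 0 := by
  have hζ0 : ζ ≠ 0 := by
    rintro rfl
    simp at hζ
  have h := (WithPiTopology.hasSum_iff_hasSum_coeff K).mp
    (hasSum_winquist (pow_ne_zero 5 hζ0) (pow_ne_zero 2 hζ0)) (11 * n + 6)
  refine eq_zero_of_hasSum_antisymm (K := K) h
    ((Equiv.subLeft (3 : ℤ)).prodCongr (Equiv.refl ℤ)) fun p => ?_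
  obtain ⟨x, y⟩ := p
  simp only [Equiv.prodCongr_apply, Prod.map, Equiv.subLeft_apply, Equiv.refl_apply]
  have hgood : Good (3 - x, y) ↔ Good (x, y) := by
    unfold Good
    simp only
    omega
  unfold wcoeff
  by_cases hp : Good (x, y)
  swap
  · rw [if_neg hp, if_neg (hgood.not.mpr hp)]
    simp
  rw [if_pos hp, if_pos (hgood.mpr hp)]
  have e1 := wexp_eq hp
  have e2 := wexp_eq (hgood.mpr hp)
  simp only at e1 e2
  have he : wexp (3 - x, y) = wexp (x, y) := by
    zify
    refine mul_left_cancel₀ (show (24 : ℤ) ≠ 0 by norm_num) ?_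
    linear_combination e2 - e1
  simp only [he, coeff_C_mul, coeff_X_pow]
  split_ifs with hN
  swap
  · simp
  rw [← hN] at e1
  -- 24(11n + 6) + 10 = 11(24n + 14).
  have hdvd : (11 : ℤ) ∣ 2 * x - 3 := by
    refine (ZMod.intCast_zmod_eq_zero_iff_dvd _ 11).mp
      (sq_add_sq_eq_zero_zmod_eleven _ ((2 * y - 1 : ℤ) : ZMod 11) ?_)
    have : (2 * x - 3) ^ 2 + (2 * y - 1) ^ 2 = 11 * (24 * n + 14 : ℤ) := by
      push_cast at e1
      linarith
    rw [← Int.cast_pow, ← Int.cast_pow, ← Int.cast_add, this, Int.cast_mul]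
    have h11 : ((11 : ℤ) : ZMod 11) = 0 := by decide
    rw [h11, zero_mul]
  obtain ⟨t, ht⟩ := hdvd
  have hx : (ζ ^ 5) ^ (3 - x) = (ζ ^ 5) ^ x := by
    rw [show 3 - x = x + 11 * (-t) by omega, zpow_add₀ (pow_ne_zero 5 hζ0), zpow_mul]
    have : ((ζ ^ 5) ^ (11 : ℤ)) = 1 := by
      rw [show (11 : ℤ) = (11 : ℕ) by rfl, zpow_natCast, ← pow_mul, mul_comm, pow_mul, hζ, one_pow]
    rw [this, one_zpow, mul_one]
  have hsg : (-1 : K) ^ wsign (3 - x, y) = -(-1) ^ wsign (x, y) := by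
    have hodd : Odd (wsign (3 - x, y) - wsign (x, y)) := by
      obtain ⟨g1, g2⟩ := hp
      simp only [wsign, Int.odd_iff] at *
      omega
    rw [show wsign (3 - x, y) = wsign (x, y) + (wsign (3 - x, y) - wsign (x, y)) by ring,
      zpow_add₀ (neg_ne_zero.mpr one_ne_zero), hodd.neg_one_zpow]
    ring
  rw [hx, hsg]
  ring

end Winquist

/-! ### Generating functions of weighted partitions. -/

section PartitionWeights

variable {K : Type*} [Field K] [UniformSpace K] [DiscreteUniformity K]

/-- For i ≠ 1 the Euler factor is geometric and cancels; the factor of the part 1 is left free so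
that its weight need not be multiplicative. -/
theorem genFun_mul_eq_of_factors {f : ℕ → ℕ → K} {g : ℕ → K} {B : K⟦X⟧}
    (h0 : (1 + ∑' j, f 1 (j + 1) • X ^ (j + 1)) * (1 - C (g 1) * X) = B)
    (h : ∀ i ≠ 1, ∀ c, f i c = g i ^ c) :
    Nat.Partition.genFun f * ∏' i : ℕ, (1 - C (g (i + 1)) * X ^ (i + 1)) = B := by
  have hm : Multipliable fun i : ℕ => (1 - C (g (i + 1)) * X ^ (i + 1) : K⟦X⟧) :=
    multipliable_one_sub fun i => (pow_dvd_pow _ (Nat.le_succ i)).mul_left _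
  have h1 := (Nat.Partition.hasProd_genFun f).mul hm.hasProd
  have h2 := hasProd_single (f := fun i : ℕ =>
    (1 + ∑' j, f (i + 1) (j + 1) • X ^ ((i + 1) * (j + 1))) * (1 - C (g (i + 1)) * X ^ (i + 1))) 0
    fun i hi => by
      set t : K⟦X⟧ := C (g (i + 1)) * X ^ (i + 1) with ht
      have ht0 : constantCoeff t = 0 := by simp [ht]
      have hs := WithPiTopology.summable_pow_of_constantCoeff_eq_zero ht0
      have h3 := WithPiTopology.tsum_pow_mul_one_sub_of_constantCoeff_eq_zero ht0
      rw [hs.tsum_eq_zero_add, pow_zero] at h3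
      rw [← h3]
      congr 2
      refine tsum_congr fun j => ?_
      rw [h (i + 1) (by omega), ht, mul_pow, ← pow_mul, smul_eq_C_mul, map_pow]
  rw [h1.unique h2]
  simpa using h0

theorem genFun_pow_mul (g : ℕ → K) :
    Nat.Partition.genFun (fun i c => g i ^ c) * ∏' i : ℕ, (1 - C (g (i + 1)) * X ^ (i + 1)) =
      1 := by
  refine genFun_mul_eq_of_factors ?_ fun _ _ _ => rfl
  have ht0 : constantCoeff (C (g 1) * X : K⟦X⟧) = 0 := by simp
  have hs := WithPiTopology.summable_pow_of_constantCoeff_eq_zero ht0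
  have h3 := WithPiTopology.tsum_pow_mul_one_sub_of_constantCoeff_eq_zero ht0
  rw [hs.tsum_eq_zero_add, pow_zero] at h3
  rw [← h3]
  congr 2
  refine tsum_congr fun j => ?_
  rw [mul_pow, smul_eq_C_mul, map_pow]

/-- The weight `0` for ones, `1` for larger parts up to `m`, and `z` for parts above `m`. -/
def cutWeight (m : ℕ) (z : K) (i : ℕ) : K := if i < 2 then 0 else if i ≤ m then 1 else z

theorem tprod_cutWeight {m : ℕ} (hm : m ≠ 0) (z : K) :
    (∏' i : ℕ, (1 - C (cutWeight m z (i + 1)) * X ^ (i + 1))) * (1 - X) =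
      qfac K m * eulerTail z m := by
  have hmul : Multipliable fun i : ℕ => (1 - C (cutWeight m z (i + m + 1)) * X ^ (i + m + 1) :
      K⟦X⟧) :=
    multipliable_one_sub fun i => (pow_dvd_pow _ (by omega)).mul_left _
  rw [← Multipliable.prod_mul_tprod_nat_mul'
    (f := fun i : ℕ => (1 - C (cutWeight m z (i + 1)) * X ^ (i + 1) : K⟦X⟧)) hmul]
  have h1 : ∏' i : ℕ, (1 - C (cutWeight m z (i + m + 1)) * X ^ (i + m + 1) : K⟦X⟧) =
      eulerTail z m := tprod_congr fun i => by
    rw [cutWeight, if_neg (by omega), if_neg (by omega)]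
  rw [h1, mul_right_comm]
  congr 1
  obtain ⟨k, rfl⟩ := Nat.exists_eq_succ_of_ne_zero hm
  rw [qfac, Finset.prod_range_succ', Finset.prod_range_succ']
  have h2 : ∀ i ∈ Finset.range k, (1 - C (cutWeight (k + 1) z (i + 1 + 1)) * X ^ (i + 1 + 1) :
      K⟦X⟧) = 1 - X ^ (i + 1 + 1) := fun i hi => by
    have := Finset.mem_range.mp hi
    rw [cutWeight, if_neg (by omega), if_pos (by omega), map_one, one_mul]
  rw [Finset.prod_congr rfl h2]
  simp [cutWeight]

theorem genFun_cutWeight_mul {m : ℕ} (hm : m ≠ 0) (z : K) :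
    Nat.Partition.genFun (fun i c => cutWeight m z i ^ c) * (qfac K m * eulerTail z m) = 1 - X := by
  rw [← tprod_cutWeight hm, ← mul_assoc, genFun_pow_mul, one_mul]

/-- The variant of `cutWeight` in which ones are permitted if there are exactly `m` of them. -/
def exactWeight (m : ℕ) (z : K) (i c : ℕ) : K :=
  if i = 1 then (if c = m then 1 else 0) else cutWeight m z i ^ c

/-- The factor 1 + X^m allows zero ones as well as m, because an absent part always has weight 1. -/
theorem genFun_exactWeight_mul {m : ℕ} (hm : m ≠ 0) (z : K) :
    Nat.Partition.genFun (exactWeight m z) * (qfac K m * eulerTail z m) =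
      (1 - X) * (1 + X ^ m) := by
  rw [← tprod_cutWeight hm, ← mul_assoc,
    genFun_mul_eq_of_factors (g := cutWeight m z) (B := 1 + X ^ m) _ fun i hi c => by
      rw [exactWeight, if_neg hi]]
  · ring
  · obtain ⟨k, rfl⟩ := Nat.exists_eq_succ_of_ne_zero hm
    rw [tsum_eq_single k fun j hj => by simp [exactWeight, hj]]
    simp [exactWeight, cutWeight]

theorem eulerTail_zero (m : ℕ) : eulerTail (0 : K) m = 1 := by
  simp [eulerTail]

theorem finsuppProd_pow {n : ℕ} (P : n.Partition) (g : ℕ → K) :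
    P.parts.toFinsupp.prod (fun i c => g i ^ c) = (P.parts.map g).prod := by
  rw [Finset.prod_multiset_map_count]
  simp [Finsupp.prod]

theorem prod_map_ite_lt (s : Multiset ℕ) (m : ℕ) (z : K) :
    (s.map fun i => if i ≤ m then 1 else z).prod = z ^ (s.filter (fun i => m < i)).card := by
  induction s using Multiset.induction_on with
  | empty => simp
  | cons a s ih =>
    rw [Multiset.map_cons, Multiset.prod_cons, ih]
    by_cases h : a ≤ m
    · rw [if_pos h, Multiset.filter_cons_of_neg _ (by omega), one_mul]
    · rw [if_neg h, Multiset.filter_cons_of_pos _ (by omega), Multiset.card_cons, pow_succ']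

theorem cutWeight_zero_prod {n : ℕ} (P : n.Partition) (m : ℕ) :
    (P.parts.map (cutWeight m (0 : K))).prod =
      if P.parts.count 1 = 0 ∧ P.parts.sup ≤ m then 1 else 0 := by
  split_ifs with h
  · refine Multiset.prod_eq_one fun x hx => ?_
    obtain ⟨i, hi, rfl⟩ := Multiset.mem_map.mp hx
    have h1 := P.parts_pos hi
    have h2 : i ≤ m := Multiset.sup_le.mp h.2 i hi
    have h3 : i ≠ 1 := by
      rintro rfl
      exact Multiset.count_eq_zero.mp h.1 hi
    rw [cutWeight, if_neg (by omega), if_pos h2]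
  · refine Multiset.prod_eq_zero (Multiset.mem_map.mpr ?_)
    by_cases h1 : P.parts.count 1 = 0
    · have h2 : ¬ P.parts.sup ≤ m := fun h2 => h ⟨h1, h2⟩
      rw [Multiset.sup_le] at h2
      push Not at h2
      obtain ⟨i, hi, him⟩ := h2
      refine ⟨i, hi, ?_⟩
      rw [cutWeight]
      split_ifs <;> first | rfl | omega
    · exact ⟨1, by simpa [Multiset.count_eq_zero] using h1, by simp [cutWeight]⟩

/-- Subtraction removes the partitions without ones and leaves those with exactly m. -/
theorem exactWeight_sub_cutWeight {n : ℕ} (P : n.Partition) {m : ℕ} (hm : m ≠ 0) (z : K) :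
    P.parts.toFinsupp.prod (exactWeight m z) - (P.parts.map (cutWeight m z)).prod =
      if P.parts.count 1 = m then z ^ (P.parts.filter (fun i => m < i)).card else 0 := by
  by_cases h0 : P.parts.count 1 = 0
  · rw [if_neg (by omega), ← finsuppProd_pow, sub_eq_zero]
    refine Finset.prod_congr rfl fun i hi => ?_
    have : i ≠ 1 := by
      rintro rfl
      simp [Multiset.count_eq_zero] at h0 hi
      exact h0 hi
    rw [exactWeight, if_neg this]
  have hmem : 1 ∈ P.parts := by simpa [Multiset.count_eq_zero] using h0
  have h1 : (P.parts.map (cutWeight m z)).prod = 0 :=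
    Multiset.prod_eq_zero (Multiset.mem_map.mpr ⟨1, hmem, by simp [cutWeight]⟩)
  rw [h1, sub_zero]
  split_ifs with h
  · rw [← prod_map_ite_lt, ← finsuppProd_pow]
    refine Finset.prod_congr rfl fun i hi => ?_
    have hip : 0 < i := P.parts_pos (by simpa using hi)
    by_cases h2 : i = 1
    · subst h2
      rw [exactWeight, if_pos rfl, Multiset.toFinsupp_apply, if_pos h]
      simp [Nat.one_le_iff_ne_zero.mpr hm]
    · rw [exactWeight, if_neg h2, cutWeight, if_neg (by omega)]
  · refine Finset.prod_eq_zero (i := 1) (by simpa using hmem) ?_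
    simp [exactWeight, h]

end PartitionWeights

/-! ### The crank generating function. -/

section CrankSeries

variable {K : Type*} [Field K] [UniformSpace K] [DiscreteUniformity K]

theorem hasSum_partition_index (idx : ∀ {n : ℕ}, n.Partition → ℕ) (v : ∀ {n : ℕ}, n.Partition → K) :
    HasSum (fun m : ℕ => (PowerSeries.mk fun n => ∑ P : n.Partition, if idx P = m then v P else 0 :
      K⟦X⟧)) (PowerSeries.mk fun n => ∑ P : n.Partition, v P) := by
  rw [WithPiTopology.hasSum_iff_hasSum_coeff]
  intro d
  simp only [coeff_mk]
  refine hasSum_sum fun P _ => ?_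
  have := hasSum_ite_eq (idx P) (v P)
  simpa [eq_comm] using this

/-- The generating function of `z ^ crank`. -/
noncomputable def crankSeries (z : K) : K⟦X⟧ :=
  PowerSeries.mk fun n => ∑ P : n.Partition, z ^ CrankMod.crank P

theorem hasSum_cauchy (A : K⟦X⟧) (w : K) :
    HasSum (fun j : ℕ => pochRatio A j * (C w * X) ^ j)
      ((euler w)⁻¹ * ∏' i : ℕ, (1 - A * C w * X ^ (i + 1))) := by
  have hs := (summable_cauchy A w 0).hasSum
  simp only [zero_add, pow_one] at hs
  rwa [← cauchy_binomial, ← mul_assoc, mul_comm _ (euler w), euler_mul_inv, one_mul]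

/-- The part of the crank generating function that comes from partitions without ones. -/
noncomputable def noOnesSeries (z : K) : K⟦X⟧ :=
  PowerSeries.mk fun n => ∑ P : n.Partition,
    if P.parts.count 1 = 0 then z ^ P.parts.sup else 0

/-- The part of the crank generating function that comes from partitions with ones. -/
noncomputable def onesSeries (z : K) : K⟦X⟧ :=
  PowerSeries.mk fun n => ∑ P : n.Partition,
    if P.parts.count 1 = 0 then 0 else z ^ CrankMod.crank P

theorem crankSeries_eq_add (z : K) : crankSeries z = noOnesSeries z + onesSeries z := by
  ext n
  simp only [crankSeries, noOnesSeries, onesSeries, map_add, coeff_mk, ← Finset.sum_add_distrib]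
  refine Finset.sum_congr rfl fun P _ => ?_
  split_ifs with h
  · simp [CrankMod.crank, h]
  · simp

/-- The generating function of partitions without ones and with all parts at most `m`. -/
noncomputable def boundedSeries (K : Type*) [Field K] (m : ℕ) : K⟦X⟧ :=
  Nat.Partition.genFun (fun i c => cutWeight m (0 : K) i ^ c)

theorem boundedSeries_mul_qfac {m : ℕ} (hm : m ≠ 0) : boundedSeries K m * qfac K m = 1 - X := by
  simpa [boundedSeries, eulerTail_zero] using genFun_cutWeight_mul hm (0 : K)

theorem boundedSeries_zero : boundedSeries K 0 = 1 := by
  have h := genFun_pow_mul (cutWeight 0 (0 : K))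
  have h0 : ∀ i, cutWeight 0 (0 : K) (i + 1) = 0 := fun i => by simp [cutWeight]
  simpa [h0, boundedSeries] using h

theorem boundedSeries_one : boundedSeries K 1 = 1 := by
  apply mul_right_cancel₀ (qfac_ne_zero (K := K) 1)
  rw [boundedSeries_mul_qfac one_ne_zero]
  simp [qfac]

theorem coeff_boundedSeries (m n : ℕ) : coeff n (boundedSeries K m) =
    ∑ P : n.Partition, if P.parts.count 1 = 0 ∧ P.parts.sup ≤ m then 1 else 0 := by
  simp only [boundedSeries, Nat.Partition.coeff_genFun, finsuppProd_pow, cutWeight_zero_prod]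

/-- For m ≥ 2 this is the difference of consecutive `boundedSeries`. The general formula gives 1 - X
at m = 0 and zX at m = 1, where the true values are 1 and 0; hence the corrections. -/
theorem noOnes_term (z : K) (m : ℕ) :
    (PowerSeries.mk fun n => ∑ P : n.Partition, if P.parts.sup = m then
      (if P.parts.count 1 = 0 then z ^ P.parts.sup else 0) else 0 : K⟦X⟧) =
    (1 - X) * (pochRatio 0 m * (C z * X) ^ m) +
      ((if m = 0 then X else 0) - if m = 1 then C z * X else 0) := by
  have hp : ∀ j, pochRatio (0 : K⟦X⟧) j = (qfac K j)⁻¹ := fun j => by simp [pochRatio]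
  cases m with
  | zero =>
    have h : (PowerSeries.mk fun n => ∑ P : n.Partition, if P.parts.sup = 0 then
        (if P.parts.count 1 = 0 then z ^ P.parts.sup else 0) else 0 : K⟦X⟧) =
        boundedSeries K 0 := by
      ext n
      rw [coeff_mk, coeff_boundedSeries]
      refine Finset.sum_congr rfl fun P _ => ?_
      by_cases h1 : P.parts.sup = 0 <;> by_cases h2 : P.parts.count 1 = 0 <;> simp [h1, h2]
    rw [h, boundedSeries_zero]
    simp
  | succ m =>
    have h : (PowerSeries.mk fun n => ∑ P : n.Partition, if P.parts.sup = m + 1 then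
        (if P.parts.count 1 = 0 then z ^ P.parts.sup else 0) else 0 : K⟦X⟧) =
        C (z ^ (m + 1)) * (boundedSeries K (m + 1) - boundedSeries K m) := by
      ext n
      rw [coeff_mk, coeff_C_mul, map_sub, coeff_boundedSeries, coeff_boundedSeries,
        ← Finset.sum_sub_distrib, Finset.mul_sum]
      refine Finset.sum_congr rfl fun P _ => ?_
      by_cases h2 : P.parts.count 1 = 0
      · rcases lt_trichotomy P.parts.sup (m + 1) with h1 | h1 | h1
        · simp [h2, h1.ne, h1.le, Nat.lt_succ_iff.mp h1]
        · simp [h2, h1]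
        · simp [h2, h1.ne', not_le.mpr h1, not_le.mpr ((Nat.lt_succ_self m).trans h1)]
      · simp [h2]
    rw [h]
    cases m with
    | zero =>
      rw [zero_add, boundedSeries_one, boundedSeries_zero, hp]
      have h1 := qfac_mul_inv (K := K) 1
      have h2 : qfac K 1 = 1 - X := by simp [qfac]
      rw [h2] at h1
      rw [h2]
      simp only [one_ne_zero, if_false, if_true, pow_one]
      linear_combination -(C z * X) * h1
    | succ k =>
      apply mul_right_cancel₀ (qfac_ne_zero (K := K) (k + 1 + 1))
      have h1 := boundedSeries_mul_qfac (K := K) (Nat.succ_ne_zero (k + 1))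
      have h2 := boundedSeries_mul_qfac (K := K) (Nat.succ_ne_zero k)
      have h3 := qfac_mul_inv (K := K) (k + 1 + 1)
      have h4 := qfac_succ (K := K) (k + 1)
      rw [if_neg (by omega), if_neg (by omega), sub_zero, add_zero, hp, mul_pow, ← map_pow]
      simp only [Nat.succ_eq_add_one] at h1 h2
      linear_combination C (z ^ (k + 1 + 1)) * h1 - C (z ^ (k + 1 + 1)) * (1 - X ^ (k + 1 + 1)) * h2 -
        C (z ^ (k + 1 + 1)) * boundedSeries K (k + 1) * h4 -
        (1 - X) * C (z ^ (k + 1 + 1)) * X ^ (k + 1 + 1) * h3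

theorem noOnesSeries_mul (z : K) :
    noOnesSeries z * euler z = (1 - X) + (X - C z * X) * euler z := by
  have h1 := hasSum_partition_index (K := K) (fun P => P.parts.sup)
    (fun P => if P.parts.count 1 = 0 then z ^ P.parts.sup else 0)
  simp_rw [noOnes_term] at h1
  have h2 := ((hasSum_cauchy (0 : K⟦X⟧) z).mul_left (1 - X)).add
    ((hasSum_ite_eq 0 (X : K⟦X⟧)).sub (hasSum_ite_eq 1 (C z * X : K⟦X⟧)))
  have h3 := h1.unique h2
  change noOnesSeries z = _ at h3
  rw [h3]
  simp only [zero_mul, sub_zero, tprod_one, mul_one]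
  linear_combination (1 - X) * euler_mul_inv z

/-- The m ones give (X/z)^m, parts above m carry z, and multiplying by `euler z` leaves a term of
Cauchy's series with A = zX, w = 1/z. -/
theorem ones_term {z : K} (hz : z ≠ 0) (m : ℕ) :
    euler z * (PowerSeries.mk fun n => ∑ P : n.Partition, if P.parts.count 1 = m then
      (if P.parts.count 1 = 0 then 0 else z ^ CrankMod.crank P) else 0 : K⟦X⟧) =
    (1 - X) * (pochRatio (C z * X) m * (C z⁻¹ * X) ^ m) - if m = 0 then 1 - X else 0 := by
  rcases eq_or_ne m 0 with rfl | hm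
  · have h : (PowerSeries.mk fun n => ∑ P : n.Partition, if P.parts.count 1 = 0 then
        (if P.parts.count 1 = 0 then 0 else z ^ CrankMod.crank P) else 0 : K⟦X⟧) = 0 := by
      ext n
      rw [coeff_mk, map_zero]
      refine Finset.sum_eq_zero fun P _ => ?_
      split_ifs <;> rfl
    rw [h]
    simp
  · have h : (PowerSeries.mk fun n => ∑ P : n.Partition, if P.parts.count 1 = m then
        (if P.parts.count 1 = 0 then 0 else z ^ CrankMod.crank P) else 0 : K⟦X⟧) =
        C (z⁻¹ ^ m) * (Nat.Partition.genFun (exactWeight m z) -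
          Nat.Partition.genFun (fun i c => cutWeight m z i ^ c)) := by
      ext n
      rw [coeff_mk, coeff_C_mul, map_sub, Nat.Partition.coeff_genFun, Nat.Partition.coeff_genFun,
        ← Finset.sum_sub_distrib, Finset.mul_sum]
      refine Finset.sum_congr rfl fun P _ => ?_
      rw [finsuppProd_pow, exactWeight_sub_cutWeight P hm]
      by_cases h1 : P.parts.count 1 = m
      · rw [if_pos h1, if_pos h1, if_neg (by omega), CrankMod.crank, if_neg (by omega), h1,
          zpow_sub₀ hz, zpow_natCast, zpow_natCast, inv_pow]
        ring
      · simp [h1]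
    rw [h, if_neg hm, sub_zero]
    have h1 := genFun_exactWeight_mul hm z
    have h2 := genFun_cutWeight_mul hm z
    have h3 := prod_mul_eulerTail z m
    have h4 := qfac_mul_inv (K := K) m
    have h5 : pochRatio (C z * X) m =
        (∏ i ∈ Finset.range m, (1 - C z * X ^ (i + 1))) * (qfac K m)⁻¹ := by
      simp only [pochRatio, mul_assoc, ← pow_succ']
    rw [← h3, h5, mul_pow, ← map_pow]
    apply mul_right_cancel₀ (qfac_ne_zero (K := K) m)
    set P := ∏ i ∈ Finset.range m, (1 - C z * X ^ (i + 1))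
    linear_combination P * C (z⁻¹ ^ m) * h1 - P * C (z⁻¹ ^ m) * h2 -
      (1 - X) * P * C (z⁻¹ ^ m) * X ^ m * h4

theorem onesSeries_mul {z : K} (hz : z ≠ 0) :
    onesSeries z * euler z * euler z⁻¹ = euler 1 - (1 - X) * euler z⁻¹ := by
  have h1 := (hasSum_partition_index (K := K) (fun P => P.parts.count 1)
    (fun P => if P.parts.count 1 = 0 then 0 else z ^ CrankMod.crank P)).mul_left (euler z)
  simp_rw [ones_term hz] at h1
  have h2 := ((hasSum_cauchy (C z * X) z⁻¹).mul_left (1 - X)).sub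
    (hasSum_ite_eq 0 (1 - X : K⟦X⟧))
  have h3 := h1.unique h2
  change euler z * onesSeries z = _ at h3
  have hC : (C z * C z⁻¹ : K⟦X⟧) = 1 := by
    rw [← map_mul, mul_inv_cancel₀ hz, map_one]
  -- A w = X, so the product in Cauchy's theorem loses z.
  have h4 : ∏' i : ℕ, (1 - C z * X * C z⁻¹ * X ^ (i + 1) : K⟦X⟧) = eulerTail 1 1 := by
    refine tprod_congr fun i => ?_
    rw [map_one, one_mul, mul_right_comm (C z) X, hC, one_mul, ← pow_succ', add_right_comm]
  have h5 := qfac_mul_eulerTail (K := K) 1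
  have h6 : qfac K 1 = 1 - X := by simp [qfac]
  rw [h6] at h5
  rw [mul_comm (onesSeries z), h3, h4]
  linear_combination (1 - X) * eulerTail 1 1 * euler_mul_inv z⁻¹ + h5

/-- The generating function of the crank, due to Andrews and Garvan. -/
theorem crankSeries_mul {z : K} (hz : z ≠ 0) :
    crankSeries z * (euler z * euler z⁻¹) =
      euler 1 + (1 - C z) * X * (euler z * euler z⁻¹) := by
  rw [crankSeries_eq_add]
  linear_combination euler z⁻¹ * noOnesSeries_mul z + onesSeries_mul hz

end CrankSeries

/-! ### Products over roots of unity and vanishing at eleventh roots. -/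

section RootsOfUnity

theorem prod_one_sub_pow_mul {R : Type*} [CommRing R] [IsDomain R] {ζ : R} {n : ℕ} (hn : 0 < n)
    (h : IsPrimitiveRoot ζ n) (t : R) : ∏ k ∈ Finset.range n, (1 - ζ ^ k * t) = 1 - t ^ n := by
  classical
  have himg : Polynomial.nthRootsFinset n (1 : R) = (Finset.range n).image (ζ ^ ·) := by
    symm
    refine Finset.eq_of_subset_of_card_le (fun x hx => ?_) ?_
    · obtain ⟨k, -, rfl⟩ := Finset.mem_image.mp hx
      rw [Polynomial.mem_nthRootsFinset hn, ← pow_mul, mul_comm, pow_mul, h.pow_eq_one, one_pow]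
    · rw [h.card_nthRootsFinset, Finset.card_image_of_injOn, Finset.card_range]
      intro i hi j hj hij
      exact h.pow_inj (Finset.mem_range.mp hi) (Finset.mem_range.mp hj) hij
  have h1 := h.pow_sub_pow_eq_prod_sub_mul 1 t hn
  rw [one_pow, himg, Finset.prod_image] at h1
  · exact h1.symm
  · intro i hi j hj hij
    exact h.pow_inj (Finset.mem_range.mp hi) (Finset.mem_range.mp hj) hij

variable {K : Type*} [Field K] [UniformSpace K] [DiscreteUniformity K]

theorem continuous_expand (n : ℕ) (hn : n ≠ 0) :
    Continuous (expand n hn : K⟦X⟧ → K⟦X⟧) := by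
  rw [continuous_iff_continuousAt]
  intro f
  rw [ContinuousAt, WithPiTopology.tendsto_iff_coeff_tendsto]
  intro d
  simp only [coeff_expand]
  split_ifs
  · exact (WithPiTopology.continuous_coeff K _).tendsto f
  · exact tendsto_const_nhds

/-- Apply ∏ (1 - ζ^k t) = 1 - t^n with t = X^(i+1), factor by factor. -/
theorem prod_euler_pow {ζ : K} {n : ℕ} (hn : n ≠ 0) (h : IsPrimitiveRoot ζ n) :
    ∏ k ∈ Finset.range n, euler (ζ ^ k) = expand n hn (euler (1 : K)) := by
  have h1 := (multipliable_euler (1 : K) 1).map_tprod (expand n hn) (continuous_expand n hn)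
  unfold euler
  rw [h1, ← Multipliable.tprod_finsetProd fun k _ => multipliable_euler (ζ ^ k) 1]
  refine tprod_congr fun i => ?_
  have h2 := prod_one_sub_pow_mul hn.bot_lt
    (h.map_of_injective (f := (C : K →+* K⟦X⟧)) C_injective) (X ^ (i + 1))
  simp only [map_pow] at h2 ⊢
  rw [h2]
  simp [expand_X, ← pow_mul, mul_comm]

/-- A series in X^t only moves exponents within their class mod t. -/
theorem coeff_mul_expand_eq_zero {f : K⟦X⟧} {t r : ℕ} (ht : t ≠ 0) (hr : r < t)
    (hf : ∀ n, coeff (t * n + r) f = 0) (g : K⟦X⟧) (n : ℕ) :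
    coeff (t * n + r) (f * expand t ht g) = 0 := by
  rw [coeff_mul]
  refine Finset.sum_eq_zero fun ij hij => ?_
  rw [Finset.HasAntidiagonal.mem_antidiagonal] at hij
  rw [coeff_expand]
  split_ifs with hd
  · obtain ⟨j, hj⟩ := hd
    have hjn : j ≤ n := by
      by_contra hc
      have : t * (n + 1) ≤ t * j := Nat.mul_le_mul_left t (by omega)
      rw [mul_add] at this
      omega
    obtain ⟨k, rfl⟩ := Nat.exists_eq_add_of_le hjn
    rw [show ij.1 = t * k + r by rw [mul_add] at hij; omega, hf, zero_mul]
  · rw [mul_zero]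

theorem coeff_crankSeries_eleven [CharZero K] {ζ : K} (h : IsPrimitiveRoot ζ 11) (n : ℕ) :
    coeff (11 * n + 6) (crankSeries ζ) = 0 := by
  have hζ : ζ ^ 11 = 1 := h.pow_eq_one
  have hζ0 : ζ ≠ 0 := h.ne_zero (by norm_num)
  have inv : ∀ i j : ℕ, i + j = 11 → (ζ ^ i)⁻¹ = ζ ^ j := fun i j hij =>
    inv_eq_of_mul_eq_one_right (by rw [← pow_add, hij, hζ])
  set c : K := (1 - ζ ^ 5) * (1 - ζ ^ 2) * (1 - ζ ^ 7) * (1 - ζ ^ 3) with hc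
  have hc0 : c ≠ 0 := by
    have : ∀ i : ℕ, 0 < i → i < 11 → 1 - ζ ^ i ≠ 0 := fun i h0 h1 h2 =>
      h.pow_ne_one_of_pos_of_lt h0.ne' h1 (sub_eq_zero.mp h2).symm
    exact mul_ne_zero (mul_ne_zero (mul_ne_zero (this 5 (by norm_num) (by norm_num))
      (this 2 (by norm_num) (by norm_num))) (this 7 (by norm_num) (by norm_num)))
      (this 3 (by norm_num) (by norm_num))
  -- The correction sits in degree 1, outside the class of 6 mod 11.
  set Z : K⟦X⟧ := crankSeries ζ - (1 - C ζ) * X with hZ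
  have hcrank : Z * (euler ζ * euler (ζ ^ 10)) = euler 1 := by
    have := crankSeries_mul hζ0
    have hi := inv 1 10 rfl
    rw [pow_one] at hi
    rw [hi] at this
    rw [hZ]
    linear_combination this
  have hprod := prod_euler_pow (by norm_num) h
  simp only [Finset.prod_range_succ, Finset.prod_range_zero, pow_zero, pow_one, one_mul] at hprod
  -- ζ^5, ζ^2, ζ^7, ζ^3 and their inverses are exactly ζ^2, …, ζ^9.
  have hwin : C c * (Z * expand 11 (by norm_num) (euler (1 : K))) = euler 1 ^ 2 *
      (thetaProd (ζ ^ 5) * thetaProd (ζ ^ 2) * thetaProd (ζ ^ 5 * ζ ^ 2) *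
        thetaProd (ζ ^ 5 / ζ ^ 2)) := by
    have e1 : ζ ^ 5 * ζ ^ 2 = ζ ^ 7 := by ring
    have e2 : ζ ^ 5 / ζ ^ 2 = ζ ^ 3 := by field_simp
    rw [e1, e2, ← hprod, hc]
    simp only [thetaProd, inv 5 6 rfl, inv 2 9 rfl, inv 7 4 rfl, inv 3 8 rfl, map_mul, map_sub,
      map_one]
    generalize C (ζ ^ 5) = c5, C (ζ ^ 2) = c2, C (ζ ^ 7) = c7, C (ζ ^ 3) = c3
    linear_combination (1 - c5) * (1 - c2) * (1 - c7) * (1 - c3) * euler 1 *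
      euler (ζ ^ 2) * euler (ζ ^ 3) * euler (ζ ^ 4) * euler (ζ ^ 5) * euler (ζ ^ 6) *
      euler (ζ ^ 7) * euler (ζ ^ 8) * euler (ζ ^ 9) * hcrank
  have hvan : ∀ n, coeff (11 * n + 6) (Z * expand 11 (by norm_num) (euler (1 : K))) = 0 :=
    fun n => by
      have h1 := coeff_winquist_eq_zero hζ n
      rw [← hwin, coeff_C_mul] at h1
      exact (mul_eq_zero.mp h1).resolve_left hc0
  have h2 := coeff_mul_expand_eq_zero (by norm_num) (by norm_num) hvan (euler (1 : K))⁻¹ n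
  rw [mul_assoc, ← map_mul, euler_mul_inv, map_one, mul_one, hZ, map_sub,
    show (1 - C ζ : K⟦X⟧) = C (1 - ζ) by rw [map_sub, map_one], coeff_C_mul, coeff_X, if_neg (by omega), mul_zero, sub_zero] at h2
  exact h2

end RootsOfUnity

/-- The crank series at a primitive eleventh root of unity has no terms in the residue class of
`6` modulo `11`. -/
theorem sum_pow_crank_eq_zero {K : Type*} [Field K] [CharZero K] {ζ : K}
    (h : IsPrimitiveRoot ζ 11) (n : ℕ) :
    ∑ P : (11 * n + 6).Partition, ζ ^ CrankMod.crank P = 0 := by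
  -- The claim is purely algebraic, so the discrete structure may be imposed locally, even for `ℂ`.
  let _ : UniformSpace K := ⊥
  have _ : DiscreteUniformity K := ⟨rfl⟩
  simpa [crankSeries] using coeff_crankSeries_eleven h n

end QSeries

/-! ### From the vanishing sums to equidistribution and the dissection element. -/

namespace CrankMod

theorem sum_ite_modEq {A : Type*} [AddCommMonoid A] {t : ℕ} (ht : t ≠ 0) (c : ℤ) (f : ℕ → A) :
    ∑ k ∈ Finset.range t, (if c ≡ k [ZMOD t] then f k else 0) = f (c % t).toNat := by
  have ht' : (t : ℤ) ≠ 0 := by exact_mod_cast ht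
  have h0 := Int.emod_nonneg c ht'
  have h1 := Int.emod_lt_of_pos c (by omega : (0 : ℤ) < t)
  rw [Finset.sum_eq_single_of_mem (c % t).toNat (Finset.mem_range.mpr (by omega))]
  · rw [if_pos]
    rw [Int.toNat_of_nonneg h0]
    exact (Int.mod_modEq c t).symm
  · intro k hk hne
    rw [if_neg]
    intro hmod
    have hk' := Finset.mem_range.mp hk
    have : c % t = k := by
      rw [hmod, Int.emod_eq_of_lt (by omega) (by omega)]
    omega

theorem sum_M_mul {A : Type*} [CommSemiring A] {t : ℕ} (ht : t ≠ 0) (n : ℕ) (f : ℕ → A) :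
    ∑ k ∈ Finset.range t, (M k t n : A) * f k =
      ∑ P : n.Partition, f (crank P % t).toNat := by
  simp_rw [← sum_ite_modEq ht]
  rw [Finset.sum_comm]
  refine Finset.sum_congr rfl fun k _ => ?_
  rw [M, Finset.card_filter, Nat.cast_sum, Finset.sum_mul]
  refine Finset.sum_congr rfl fun P _ => ?_
  split_ifs <;> simp

theorem sum_M_mul_pow {K : Type*} [Field K] {ζ : K} {t : ℕ} (ht : t ≠ 0) (hζ : ζ ^ t = 1) (n : ℕ) :
    ∑ k ∈ Finset.range t, (M k t n : K) * ζ ^ k = ∑ P : n.Partition, ζ ^ crank P := by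
  rw [sum_M_mul ht]
  refine Finset.sum_congr rfl fun P _ => ?_
  have hζ0 : ζ ≠ 0 := by
    rintro rfl
    simp [ht] at hζ
  rw [← zpow_natCast, Int.toNat_of_nonneg (Int.emod_nonneg _ (by exact_mod_cast ht))]
  conv_rhs => rw [← Int.emod_add_mul_ediv (crank P) t, zpow_add₀ hζ0, zpow_mul, zpow_natCast, hζ,
    one_zpow, mul_one]

theorem sum_M (t : ℕ) (ht : t ≠ 0) (n : ℕ) : ∑ k ∈ Finset.range t, M k t n = p n := by
  simpa [p] using sum_M_mul ht n (fun _ => (1 : ℕ))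

/-- A rational linear relation between the powers of a root of unity of prime order is a multiple
of the trivial one. -/
theorem eq_of_sum_mul_pow_eq_zero {K : Type*} [Field K] [CharZero K] {ζ : K} {t : ℕ}
    (ht : t.Prime) (h : IsPrimitiveRoot ζ t) {m : ℕ → ℚ}
    (hm : ∑ k ∈ Finset.range t, (m k : K) * ζ ^ k = 0) {i : ℕ} (hi : i < t) :
    m i = m (t - 1) := by
  obtain ⟨d, rfl⟩ := Nat.exists_eq_succ_of_ne_zero ht.ne_zero
  have hgeom := h.geom_sum_eq_zero ht.one_lt
  rw [Finset.sum_range_succ] at hgeom hm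
  have hdeg : (minpoly ℚ ζ).natDegree = d := by
    rw [← Polynomial.cyclotomic_eq_minpoly_rat h ht.pos, Polynomial.natDegree_cyclotomic,
      Nat.totient_prime ht]
    rfl
  have hli := linearIndependent_pow (K := ℚ) ζ
  rw [hdeg, Fintype.linearIndependent_iff] at hli
  -- Subtracting `m d` times the geometric sum removes the top power; the remaining d powers are
  -- independent, as the cyclotomic polynomial has degree d.
  have hsum : ∑ k : Fin d, (m k - m d) • ζ ^ (k : ℕ) = 0 := by
    rw [Fin.sum_univ_eq_sum_range (fun k => (m k - m d) • ζ ^ k)]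
    simp only [Algebra.smul_def, map_sub, eq_ratCast, sub_mul, Finset.sum_sub_distrib,
      ← Finset.mul_sum]
    linear_combination hm - (m d : K) * hgeom
  rcases Nat.lt_succ_iff_lt_or_eq.mp hi with hlt | rfl
  · exact sub_eq_zero.mp (hli (fun k => m k - m d) hsum ⟨i, hlt⟩)
  · rfl

theorem zeta_isPrimitiveRoot : IsPrimitiveRoot (zeta 11) 11 :=
  Complex.isPrimitiveRoot_exp 11 (by norm_num)

theorem sum_M_mul_zeta_eq_zero (n : ℕ) :
    ∑ k ∈ Finset.range 11, (M k 11 (11 * n + 6) : ℂ) * zeta 11 ^ k = 0 := by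
  rw [sum_M_mul_pow (by norm_num) zeta_isPrimitiveRoot.pow_eq_one]
  exact QSeries.sum_pow_crank_eq_zero zeta_isPrimitiveRoot n

theorem M_eq_p_div (n r : ℕ) (hr : r ≤ 10) :
    (M r 11 (11 * n + 6) : ℚ) = (p (11 * n + 6) : ℚ) / 11 := by
  have h1 : ∀ i : ℕ, i < 11 → (M i 11 (11 * n + 6) : ℚ) = M (10 : ℕ) 11 (11 * n + 6) := fun i hi => by
    have := eq_of_sum_mul_pow_eq_zero (t := 11) (by norm_num) zeta_isPrimitiveRoot
      (m := fun k : ℕ => (M (k : ℤ) 11 (11 * n + 6) : ℚ))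
      (by simpa using sum_M_mul_zeta_eq_zero n) hi
    exact this
  have h2 := congrArg (Nat.cast : ℕ → ℚ) (sum_M 11 (by norm_num) (11 * n + 6))
  rw [Nat.cast_sum, Finset.sum_congr rfl fun i hi => h1 i (Finset.mem_range.mp hi)] at h2
  rw [h1 r (by omega), ← h2]
  simp

theorem startIndex_eleven_zero : startIndex 11 0 = 1 := by
  have : s 11 = 5 := rfl
  rw [startIndex, this, Nat.ceil_eq_iff one_ne_zero]
  norm_num

theorem dissectionTerm_eleven_eq_zero (z : UpperHalfPlane) (n : Set.Ici (startIndex 11 0)) :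
    dissectionTerm 11 0 1 z n = 0 := by
  obtain ⟨n, hn⟩ := n
  rw [startIndex_eleven_zero, Set.mem_Ici] at hn
  obtain ⟨k, rfl⟩ := Nat.exists_eq_add_of_le hn
  have hs : s 11 = 5 := rfl
  -- Since the series starts at ⌈5/11⌉ = 1, its arguments 11n - 5 are exactly the 11k + 6.
  have hidx : 11 * (1 + k) + 0 - s 11 = 11 * k + 6 := by omega
  simp only [dissectionTerm, hidx, mul_one]
  rw [sum_M_mul_zeta_eq_zero, zero_mul]

theorem K_eleven_eq_zero (z : UpperHalfPlane) : K 11 0 1 z = 0 := by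
  simp [K, dissectionTerm_eleven_eq_zero z]

theorem multipliable_one_sub_q_pow (z : UpperHalfPlane) {t : ℕ} (ht : t ≠ 0) :
    Multipliable fun n : ℕ => 1 - q z ^ (t * (n + 1)) := by
  have hq : ‖q z ^ t‖ < 1 := by
    rw [norm_pow]
    exact pow_lt_one₀ (norm_nonneg _) (UpperHalfPlane.norm_exp_two_pi_I_lt_one z) ht
  simp_rw [sub_eq_add_neg]
  refine multipliable_one_add_of_summable ?_
  simp_rw [norm_neg, pow_mul, norm_pow _ (_ + 1)]
  exact (summable_nat_add_iff 1).mpr (summable_geometric_of_lt_one (norm_nonneg _) hq)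

end CrankMod

theorem mainTheorem8 :
    (∀ z : UpperHalfPlane,
      Multipliable (fun n : ℕ => 1 - CrankMod.q z ^ (11 * (n + 1))) ∧
      Summable (fun n : Set.Ici (CrankMod.startIndex 11 0) =>
        CrankMod.dissectionTerm 11 0 1 z n) ∧
      CrankMod.K 11 0 1 z = 0) ∧
    (∀ n r : ℕ, r ≤ 10 →
      (CrankMod.M r 11 (11 * n + 6) : ℚ) = (CrankMod.p (11 * n + 6) : ℚ) / 11) ∧
    ((∀ z : UpperHalfPlane, CrankMod.K 11 0 1 z = 0) ↔
      (∀ n r : ℕ, r ≤ 10 →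
        (CrankMod.M r 11 (11 * n + 6) : ℚ) = (CrankMod.p (11 * n + 6) : ℚ) / 11)) := by
  -- Both sides of the equivalence are proved outright, so each implication ignores its premise.
  refine ⟨fun z => ⟨CrankMod.multipliable_one_sub_q_pow z (by norm_num), ?_,
    CrankMod.K_eleven_eq_zero z⟩, CrankMod.M_eq_p_div,
    fun _ => CrankMod.M_eq_p_div, fun _ => CrankMod.K_eleven_eq_zero⟩
  rw [show (fun n : Set.Ici (CrankMod.startIndex 11 0) => CrankMod.dissectionTerm 11 0 1 z n) =
    fun _ => 0 from funext (CrankMod.dissectionTerm_eleven_eq_zero z)]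
  exact summable_zero
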